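/- Let $G$ be a finite cyclic group of order $N$. For a $3$-cocycle $\omega\colon G^3\to\mathbb{C}^\times$ (trivial action, class $[\omega]\in H^3(G,\mathbb{C}^\times)$) let $\mathcal{C}(G,\omega)$ be the category of finite-dimensional $G$-graded complex vector spaces with the usual tensor product of graded spaces and the associativity constraint $(u\otimes v)\otimes w\mapsto\omega(|u|,|v|,|w|)\,u\otimes(v\otimes w)$ for homogeneous $u,v,w$, equipped with its canonical pivotal structure $j$, for which the pivotal dimension of every object is its vector space dimension. (If $\omega$ is not normalized, the unit constraints are $1\otimes v\mapsto\omega(1,1,|v|)^{-1}v$ and $v\otimes 1\mapsto\omega(|v|,1,1)v$.) For an object $V$ and $n\ge1$ let $E_V^{(n)}$ be the linear endomorphism of $\mathrm{Hom}(I,V^{\otimes n})$, where $V^{\otimes n}=V\otimes V^{\otimes(n-1)}$, that sends $f\colon I\to V\otimes W$, $W=V^{\otimes (n-1)}$, to $$I\to V^\vee\otimes V^{\vee\vee}\xrightarrow{(V^\vee\otimes f)\otimes V^{\vee\vee}}(V^\vee\otimes(V\otimes W))\otimes V^{\vee\vee}\to W\otimes V^{\vee\vee}\xrightarrow{W\otimes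 j^{-1}}W\otimes V\cong V^{\otimes n},$$ the unlabelled arrows being given by coevaluation, by associativity and evaluation, and by rebracketing. Let $\nu_n(V)=\mathrm{Tr}(E_V^{(n)})$ be the $n$-th Frobenius–Schur indicator of $V$. The Frobenius–Schur exponent $\mathrm{FSexp}(V)$ is the least integer $n\ge1$ such that $\nu_n(V)$ equals the left pivotal dimension of $V$ ($\infty$ if there is none), and $\mathrm{FSexp}(\mathcal{C}(G,\omega))=\sup_V\mathrm{FSexp}(V)$ over all objects $V$. Then for every $3$-cocycle $\omega$ on $G$ $$\mathrm{FSexp}(\mathcal{C}(G,\omega))=N\cdot\mathrm{ord}([\omega]).$$ In particular $\mathrm{FSexp}(\mathcal{C}(G,\omega))$ is finite and $N\mid\mathrm{FSexp}(\mathcal{C}(G,\omega))\mid N^2$; for each divisor $n$ of $N$ there is a $3$-cocycle $\omega$ with $\mathrm{FSexp}(\mathcal{C}(G,\omega))=Nn$. In particular the value $N^2$ is attained for some $\omega$. -/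

import Mathlib

noncomputable section

set_option linter.unusedSectionVars false
set_option linter.unusedVariables false

namespace FrobeniusSchur

open CategoryTheory MonoidalCategory

section Pivotal

universe v u

theorem eval_injective {C : Type u} [Category.{v} C] [MonoidalCategory C] {V X Y : C} [ExactPairing X Y] {f g : V ⟶ Y}
    (h : f ▷ X ≫ ε_ X Y = g ▷ X ≫ ε_ X Y) : f = g := by
  let _ : HasRightDual X := ⟨Y⟩
  have h1 := tensorRightHomEquiv_whiskerRight_comp_evaluation (X := X) f
  have h2 := tensorRightHomEquiv_whiskerRight_comp_evaluation (X := X) g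
  rw [← cancel_mono (λ_ _).inv]
  exact h1.symm.trans ((congrArg _ h).trans h2)

variable {C : Type u} [Category.{v} C] [MonoidalCategory C] [RightRigidCategory C]

/-- The chosen dual `V^∨`, with coevaluation `η : 𝟙 ⟶ V ⊗ V^∨` and evaluation
`ε : V^∨ ⊗ V ⟶ 𝟙`. (Texts that call this the left dual and Mathlib, where it is the right dual,
differ only in the name.) -/
abbrev dual (V : C) : C := HasRightDual.rightDual V

/-- The transpose `f^∨ : W^∨ ⟶ V^∨` of `f : V ⟶ W`. -/
abbrev dualMap {V W : C} (f : V ⟶ W) : dual W ⟶ dual V := rightAdjointMate f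

/-- The canonical isomorphism `(V ⊗ W)^∨∨ ≅ V^∨∨ ⊗ W^∨∨`, i.e. the monoidal structure of the double
dual functor. -/
def doubleDualTensor (V W : C) : dual (dual (V ⊗ W)) ⟶ dual (dual V) ⊗ dual (dual W) :=
  dualMap (rightDualTensorIso V W).inv ≫ (rightDualTensorIso (dual W) (dual V)).hom

variable (C) in
/-- A pivotal structure: an isomorphism `j : V ≅ V^∨∨` of monoidal functors. -/
structure PivotalStructure where
  /-- the components of the isomorphism -/
  iso : ∀ V : C, V ≅ dual (dual V)
  naturality : ∀ {V W : C} (f : V ⟶ W), f ≫ (iso W).hom = (iso V).hom ≫ dualMap (dualMap f)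
  tensor : ∀ V W : C,
    (iso (V ⊗ W)).hom ≫ doubleDualTensor V W = (iso V).hom ⊗ₘ (iso W).hom

theorem rightDualTensorIso_hom_eval (V W : C) :
    (rightDualTensorIso V W).hom ▷ (V ⊗ W) ≫ ε_ (V ⊗ W) (dual W ⊗ dual V) =
      ε_ (V ⊗ W) (dual (V ⊗ W)) := by
  have := @rightAdjointMate_comp_evaluation C _ _ (V ⊗ W) (V ⊗ W) ⟨dual W ⊗ dual V⟩ _ (𝟙 (V ⊗ W))
  simpa [rightDualTensorIso, rightDualIso] using this

theorem rightDualTensorIso_inv_eval (V W : C) :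
    (rightDualTensorIso V W).inv ▷ (V ⊗ W) ≫ ε_ (V ⊗ W) (dual (V ⊗ W)) =
      ε_ (V ⊗ W) (dual W ⊗ dual V) := by
  rw [← rightDualTensorIso_hom_eval, ← comp_whiskerRight_assoc]
  simp

/-- To verify that `j` is monoidal it is enough to compare evaluations. -/
theorem monoidal_of_eval (V W : C) (jVW : V ⊗ W ⟶ dual (dual (V ⊗ W)))
    (f : V ⊗ W ⟶ dual (dual V) ⊗ dual (dual W))
    (h : (V ⊗ W) ◁ (rightDualTensorIso V W).inv ≫ jVW ▷ dual (V ⊗ W) ≫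
        ε_ (dual (V ⊗ W)) (dual (dual (V ⊗ W)))
      = f ▷ (dual W ⊗ dual V) ≫ ε_ (dual W ⊗ dual V) (dual (dual V) ⊗ dual (dual W))) :
    jVW ≫ doubleDualTensor V W = f := by
  apply eval_injective (X := dual W ⊗ dual V)
  rw [← h, doubleDualTensor, comp_whiskerRight, comp_whiskerRight, Category.assoc, Category.assoc,
    rightDualTensorIso_hom_eval, rightAdjointMate_comp_evaluation, ← whisker_exchange_assoc]

/-- The left pivotal dimension of `V`, as an endomorphism of the unit object. -/
def leftDim (j : PivotalStructure C) (V : C) : 𝟙_ C ⟶ 𝟙_ C :=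
  η_ (dual V) (dual (dual V)) ≫ dual V ◁ (j.iso V).inv ≫ ε_ V (dual V)

/-- Right-nested tensor powers: `V^{⊗ 0} = 𝟙` and `V^{⊗ (n + 1)} = V ⊗ V^{⊗ n}`. -/
def tpow {C : Type u} [Category.{v} C] [MonoidalCategory C] (V : C) : ℕ → C
  | 0 => 𝟙_ C
  | n + 1 => V ⊗ tpow V n

/-- The rebracketing isomorphism `V^{⊗ n} ⊗ V ≅ V ⊗ V^{⊗ n} = V^{⊗ (n + 1)}`. -/
def rebracket {C : Type u} [Category.{v} C] [MonoidalCategory C] (V : C) :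
    ∀ n : ℕ, tpow V n ⊗ V ≅ V ⊗ tpow V n
  | 0 => λ_ V ≪≫ (ρ_ V).symm
  | n + 1 => α_ V (tpow V n) V ≪≫ whiskerLeftIso V (rebracket V n)

variable (k : Type*) [Field k] [Preadditive C] [Linear k C] [MonoidalPreadditive C]
  [MonoidalLinear k C]

/-- The map `D : Hom(𝟙, V ⊗ W) → Hom(𝟙, W ⊗ V^∨∨)`. -/
def mapD (V W : C) : (𝟙_ C ⟶ V ⊗ W) →ₗ[k] (𝟙_ C ⟶ W ⊗ dual (dual V)) where
  toFun f := η_ (dual V) (dual (dual V)) ≫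
    ((ρ_ (dual V)).inv ≫ dual V ◁ f ≫ (α_ (dual V) V W).inv ≫
      ε_ V (dual V) ▷ W ≫ (λ_ W).hom) ▷ dual (dual V)
  map_add' f g := by simp [MonoidalPreadditive.add_whiskerRight, MonoidalPreadditive.whiskerLeft_add]
  map_smul' c f := by simp [MonoidalLinear.smul_whiskerRight, MonoidalLinear.whiskerLeft_smul]

/-- The map `E : Hom(𝟙, V ⊗ W) → Hom(𝟙, W ⊗ V)`, `E f = (W ⊗ j⁻¹) ∘ D f`. -/
def mapE (j : PivotalStructure C) (V W : C) : (𝟙_ C ⟶ V ⊗ W) →ₗ[k] (𝟙_ C ⟶ W ⊗ V) :=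
  Linear.rightComp k (𝟙_ C) (W ◁ (j.iso V).inv) ∘ₗ mapD k V W

/-- The endomorphism `E_V^{(n + 1)}` of `Hom(𝟙, V^{⊗ (n + 1)})`: first
`E : Hom(𝟙, V ⊗ V^{⊗ n}) → Hom(𝟙, V^{⊗ n} ⊗ V)`, then rebracketing. -/
def powE (j : PivotalStructure C) (V : C) (n : ℕ) :
    (𝟙_ C ⟶ V ⊗ tpow V n) →ₗ[k] (𝟙_ C ⟶ V ⊗ tpow V n) :=
  Linear.rightComp k (𝟙_ C) (rebracket V n).hom ∘ₗ mapE k j V (tpow V n)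

/-- The `n`-th Frobenius–Schur indicator `ν_n(V) = Tr E_V^{(n)}`, for `n ≥ 1`. (The value at `n = 0`
is a placeholder that is never used.) -/
def indicator [∀ X Y : C, Module.Finite k (X ⟶ Y)] (j : PivotalStructure C) (V : C) : ℕ → k
  | 0 => 0
  | n + 1 => LinearMap.trace k (𝟙_ C ⟶ V ⊗ tpow V n) (powE k j V n)

/-- The Frobenius–Schur exponent of an object: the least `n ≥ 1` such that `ν_n(V) = d_ℓ(V)`
(scalars being identified with multiples of the identity of the unit object), and `∞` if there is
none. -/
def fsExpObj [∀ X Y : C, Module.Finite k (X ⟶ Y)] (j : PivotalStructure C) (V : C) : ℕ∞ :=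
  ⨅ (n : ℕ) (_ : 0 < n ∧ indicator k j V n • 𝟙 (𝟙_ C) = leftDim j V), (n : ℕ∞)

/-- The Frobenius–Schur exponent of a pivotal category: the supremum over all its objects. -/
def fsExp [∀ X Y : C, Module.Finite k (X ⟶ Y)] (j : PivotalStructure C) : ℕ∞ :=
  ⨆ V : C, fsExpObj k j V

end Pivotal
end FrobeniusSchur
end

noncomputable section

set_option linter.unusedSectionVars false
set_option linter.unusedVariables false

open CategoryTheory

/-- A `ℂˣ`-valued (inhomogeneous, not necessarily normalized) `3`-cocycle on the group `G`, with
trivial action of `G` on `ℂˣ`. -/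
structure ThreeCocycle (G : Type) [Group G] where
  /-- the underlying cochain -/
  toFun : G → G → G → ℂˣ
  cocycle : ∀ a b c d : G, toFun b c d * toFun a (b * c) d * toFun a b c =
    toFun (a * b) c d * toFun a b (c * d)

namespace ThreeCocycle

variable {G : Type} [Group G]

instance : CoeFun (ThreeCocycle G) (fun _ => G → G → G → ℂˣ) := ⟨ThreeCocycle.toFun⟩

/-- The trivial `G`-module `ℂˣ`, written additively. -/
abbrev units (G : Type) [Group G] : Rep ℤ G := Rep.trivial ℤ G (Additive ℂˣ)

theorem rearrange {A : Type*} [AddCommGroup A] {p q r s t : A} (h : p + q + r = s + t) :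
    p + (-s + (q + (-t + r))) = 0 := by
  rw [← sub_eq_zero] at h
  rw [← h]
  abel

theorem d_eq_zero (ω : ThreeCocycle G) :
    inhomogeneousCochains.d (units G) 3
      (fun x => Additive.ofMul (ω (x 0) (x 1) (x 2))) = 0 := by
  funext x
  have h := congrArg Additive.ofMul (ω.cocycle (x 0) (x 1) (x 2) (x 3))
  simp [inhomogeneousCochains.d, Fin.sum_univ_succ, Fin.contractNth] at h ⊢
  exact rearrange h

/-- The class `[ω]` in `H³(G, ℂˣ)`. -/
def cohomologyClass (ω : ThreeCocycle G) : groupCohomology (units G) 3 :=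
  groupCohomology.π (units G) 3
    (groupCohomology.cocyclesMk (fun x => Additive.ofMul (ω (x 0) (x 1) (x 2))) ω.d_eq_zero)

end ThreeCocycle

end

noncomputable section

set_option linter.unusedSectionVars false
set_option linter.unusedVariables false

open CategoryTheory MonoidalCategory TensorProduct FrobeniusSchur

variable {G : Type} [Group G]

/-- An object of `C(G, ω)`: a finite-dimensional complex vector space graded by `G`, the grading
`V = ⨁_g V_g` being recorded by the projections `proj g` of `V` onto the homogeneous components. -/
structure GVec [Fintype G] (ω : ThreeCocycle G) : Type 1 where
  /-- the underlying vector space -/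
  carrier : Type
  [addCommGroup : AddCommGroup carrier]
  [module : Module ℂ carrier]
  [finite : Module.Finite ℂ carrier]
  /-- the projection to the component of degree `g` -/
  proj : G → carrier →ₗ[ℂ] carrier
  proj_proj : ∀ g v, proj g (proj g v) = proj g v
  proj_proj_of_ne : ∀ g h v, g ≠ h → proj g (proj h v) = 0
  sum_proj : ∀ v, ∑ g, proj g v = v

namespace GVec

variable [Fintype G] {ω : ThreeCocycle G}

attribute [instance] addCommGroup module finite

/-- `v` is homogeneous of degree `g`. -/
def IsHom (V : GVec ω) (g : G) (v : V.carrier) : Prop := V.proj g v = v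

theorem isHom_proj (V : GVec ω) (g : G) (v : V.carrier) : V.IsHom g (V.proj g v) := V.proj_proj g v

theorem IsHom.proj_of_ne {V : GVec ω} {g h : G} {v : V.carrier} (hv : V.IsHom g v) (hne : g ≠ h) :
    V.proj h v = 0 := by
  rw [← hv, V.proj_proj_of_ne _ _ _ hne.symm]

theorem lin_ext {V : GVec ω} {M : Type*} [AddCommGroup M] [Module ℂ M]
    {f g : V.carrier →ₗ[ℂ] M} (h : ∀ a v, V.IsHom a v → f v = g v) : f = g := by
  ext v
  rw [← V.sum_proj v, map_sum, map_sum]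
  exact Finset.sum_congr rfl fun a _ => h a _ (V.isHom_proj a v)

/-- Morphisms of `C(G, ω)`: linear maps preserving the grading. -/
@[ext]
structure Hom (V W : GVec ω) where
  /-- the underlying linear map -/
  lin : V.carrier →ₗ[ℂ] W.carrier
  comm : ∀ g v, W.proj g (lin v) = lin (V.proj g v)

instance : Category (GVec ω) where
  Hom V W := Hom V W
  id V := ⟨LinearMap.id, fun _ _ => rfl⟩
  comp f g := ⟨g.lin ∘ₗ f.lin, fun a v => by simp [f.comm, g.comm]⟩

/-- The linear map underlying a morphism. -/
def lin {V W : GVec ω} (f : V ⟶ W) : V.carrier →ₗ[ℂ] W.carrier := Hom.lin f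

theorem lin_comm {V W : GVec ω} (f : V ⟶ W) (g : G) (v : V.carrier) :
    W.proj g (lin f v) = lin f (V.proj g v) := Hom.comm f g v

theorem IsHom.lin {V W : GVec ω} (f : V ⟶ W) {a : G} {v : V.carrier} (hv : V.IsHom a v) :
    W.IsHom a (GVec.lin f v) := by
  rw [IsHom, lin_comm, hv]

theorem lin_injective {V W : GVec ω} : Function.Injective (lin : (V ⟶ W) → _) :=
  fun _ _ h => Hom.ext h

@[simp] theorem lin_id (V : GVec ω) : lin (𝟙 V) = LinearMap.id := rfl
@[simp] theorem lin_comp {U V W : GVec ω} (f : U ⟶ V) (g : V ⟶ W) :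
    lin (f ≫ g) = lin g ∘ₗ lin f := rfl

/-- Degree-preserving linear maps form a linear subspace. -/
def homSubmodule (V W : GVec ω) : Submodule ℂ (V.carrier →ₗ[ℂ] W.carrier) where
  carrier := {f | ∀ g v, W.proj g (f v) = f (V.proj g v)}
  add_mem' hf hg a v := by simp [hf a v, hg a v]
  zero_mem' a v := by simp
  smul_mem' c f hf a v := by simp [hf a v]

/-- Morphisms as elements of `homSubmodule`. -/
def homEquiv (V W : GVec ω) : (V ⟶ W) ≃ homSubmodule V W where
  toFun f := ⟨lin f, lin_comm f⟩
  invFun f := ⟨f.1, f.2⟩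
  left_inv _ := rfl
  right_inv _ := rfl

instance : Preadditive (GVec ω) where
  homGroup V W := (homEquiv V W).addCommGroup
  add_comp _ _ _ f f' g := lin_injective (LinearMap.comp_add (lin f) (lin f') (lin g))
  comp_add _ _ _ _ _ _ := lin_injective (LinearMap.add_comp _ _ _)

@[simp] theorem lin_add {V W : GVec ω} (f g : V ⟶ W) : lin (f + g) = lin f + lin g := rfl
@[simp] theorem lin_zero {V W : GVec ω} : lin (0 : V ⟶ W) = 0 := rfl

instance : Linear ℂ (GVec ω) where
  homModule V W := (homEquiv V W).module ℂ
  smul_comp _ _ _ c f g := lin_injective (LinearMap.comp_smul (lin g) c (lin f))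
  comp_smul _ _ _ f c g := lin_injective (LinearMap.smul_comp c (lin g) (lin f))

@[simp] theorem lin_smul {V W : GVec ω} (c : ℂ) (f : V ⟶ W) : lin (c • f) = c • lin f := rfl

/-- `lin` as a linear map. -/
def linₗ (V W : GVec ω) : (V ⟶ W) →ₗ[ℂ] (V.carrier →ₗ[ℂ] W.carrier) where
  toFun := lin
  map_add' := lin_add
  map_smul' := lin_smul

instance (V W : GVec ω) : Module.Finite ℂ (V ⟶ W) :=
  Module.Finite.of_injective (linₗ V W) lin_injective

/-- The tensor product: the grading of `V ⊗ W` is `(V ⊗ W)_g = ⨁_{hk = g} V_h ⊗ W_k`. -/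
abbrev tensorObj (V W : GVec ω) : GVec ω where
  carrier := V.carrier ⊗[ℂ] W.carrier
  proj g := ∑ h, TensorProduct.map (V.proj h) (W.proj (h⁻¹ * g))
  proj_proj g v := by
    induction v using TensorProduct.induction_on with
    | zero => simp
    | add x y hx hy => simp only [map_add, hx, hy]
    | tmul x y =>
      simp only [LinearMap.sum_apply, TensorProduct.map_tmul, map_sum]
      refine Finset.sum_congr rfl fun h _ => ?_
      rw [Finset.sum_eq_single h]
      · rw [V.proj_proj, W.proj_proj]
      · intro b _ hb; rw [V.proj_proj_of_ne _ _ _ hb]; simp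
      · simp
  proj_proj_of_ne g h v hgh := by
    induction v using TensorProduct.induction_on with
    | zero => simp
    | add x y hx hy => simp only [map_add, hx, hy, add_zero]
    | tmul x y =>
      simp only [LinearMap.sum_apply, TensorProduct.map_tmul, map_sum]
      refine Finset.sum_eq_zero fun a _ => Finset.sum_eq_zero fun b _ => ?_
      by_cases hab : b = a
      · subst hab; rw [W.proj_proj_of_ne _ _ _ (by simpa using hgh)]; simp
      · rw [V.proj_proj_of_ne _ _ _ hab]; simp
  sum_proj v := by
    induction v using TensorProduct.induction_on with
    | zero => simp
    | add x y hx hy => simp only [map_add, Finset.sum_add_distrib, hx, hy]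
    | tmul x y =>
      simp only [LinearMap.sum_apply, TensorProduct.map_tmul]
      rw [Finset.sum_comm]
      have : ∀ h, ∑ g, V.proj h x ⊗ₜ[ℂ] W.proj (h⁻¹ * g) y = V.proj h x ⊗ₜ y := fun h => by
        rw [← TensorProduct.tmul_sum]
        congr 1
        rw [← W.sum_proj y]
        refine Fintype.sum_equiv (Equiv.mulLeft h⁻¹) _ _ fun g => ?_
        rw [W.sum_proj y]; rfl
      simp only [this, ← TensorProduct.sum_tmul, V.sum_proj]

theorem IsHom.tmul {V W : GVec ω} {a b : G} {v : V.carrier} {w : W.carrier} (hv : V.IsHom a v)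
    (hw : W.IsHom b w) : (tensorObj V W).IsHom (a * b) (v ⊗ₜ[ℂ] w) := by
  change (∑ h, TensorProduct.map (V.proj h) (W.proj (h⁻¹ * (a * b)))) _ = _
  simp only [LinearMap.sum_apply, TensorProduct.map_tmul]
  rw [Finset.sum_eq_single a]
  · rw [inv_mul_cancel_left, hv, hw]
  · intro c _ hc; rw [hv.proj_of_ne hc.symm]; simp
  · simp

theorem tensor_ext {V W : GVec ω} {M : Type*} [AddCommGroup M] [Module ℂ M]
    {f g : (tensorObj V W).carrier →ₗ[ℂ] M}
    (h : ∀ a b v w, V.IsHom a v → W.IsHom b w → f (v ⊗ₜ[ℂ] w) = g (v ⊗ₜ[ℂ] w)) : f = g :=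
  TensorProduct.ext (lin_ext fun a v hv => lin_ext fun b w hw => h a b v w hv hw)

theorem tensor_ext_left {U V W : GVec ω} {M : Type*} [AddCommGroup M] [Module ℂ M]
    {f g : (tensorObj (tensorObj U V) W).carrier →ₗ[ℂ] M}
    (h : ∀ a b c u v w, U.IsHom a u → V.IsHom b v → W.IsHom c w →
      f ((u ⊗ₜ[ℂ] v) ⊗ₜ[ℂ] w) = g ((u ⊗ₜ[ℂ] v) ⊗ₜ[ℂ] w)) : f = g :=
  TensorProduct.ext (tensor_ext fun a b u v hu hv => lin_ext fun c w hw => h a b c u v w hu hv hw)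

theorem tensor_ext_right {U V W : GVec ω} {M : Type*} [AddCommGroup M] [Module ℂ M]
    {f g : (tensorObj U (tensorObj V W)).carrier →ₗ[ℂ] M}
    (h : ∀ a b c u v w, U.IsHom a u → V.IsHom b v → W.IsHom c w →
      f (u ⊗ₜ[ℂ] (v ⊗ₜ[ℂ] w)) = g (u ⊗ₜ[ℂ] (v ⊗ₜ[ℂ] w))) : f = g :=
  TensorProduct.ext (lin_ext fun a u hu => tensor_ext fun b c v w hv hw => h a b c u v w hu hv hw)

/-- The linear map `(U ⊗ V) ⊗ W → U ⊗ (V ⊗ W)`,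
`(u ⊗ v) ⊗ w ↦ ω(|u|, |v|, |w|) u ⊗ (v ⊗ w)` on homogeneous elements. -/
def assocLin (U V W : GVec ω) : (U.carrier ⊗[ℂ] V.carrier) ⊗[ℂ] W.carrier →ₗ[ℂ]
    U.carrier ⊗[ℂ] (V.carrier ⊗[ℂ] W.carrier) :=
  ∑ a, ∑ b, ∑ c, (ω a b c : ℂ) • ((TensorProduct.assoc ℂ U.carrier V.carrier W.carrier).toLinearMap ∘ₗ
    TensorProduct.map (TensorProduct.map (U.proj a) (V.proj b)) (W.proj c))

/-- The inverse of `assocLin`. -/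
def assocInvLin (U V W : GVec ω) : U.carrier ⊗[ℂ] (V.carrier ⊗[ℂ] W.carrier) →ₗ[ℂ]
    (U.carrier ⊗[ℂ] V.carrier) ⊗[ℂ] W.carrier :=
  ∑ a, ∑ b, ∑ c, ((ω a b c)⁻¹ : ℂ) •
    ((TensorProduct.assoc ℂ U.carrier V.carrier W.carrier).symm.toLinearMap ∘ₗ
      TensorProduct.map (U.proj a) (TensorProduct.map (V.proj b) (W.proj c)))

theorem assocLin_tmul {U V W : GVec ω} {a b c : G} {u : U.carrier} {v : V.carrier} {w : W.carrier}
    (hu : U.IsHom a u) (hv : V.IsHom b v) (hw : W.IsHom c w) :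
    assocLin U V W ((u ⊗ₜ[ℂ] v) ⊗ₜ[ℂ] w) = (ω a b c : ℂ) • (u ⊗ₜ[ℂ] (v ⊗ₜ[ℂ] w)) := by
  simp only [assocLin, LinearMap.sum_apply, LinearMap.smul_apply, LinearMap.comp_apply,
    TensorProduct.map_tmul]
  rw [Finset.sum_eq_single a, Finset.sum_eq_single b, Finset.sum_eq_single c]
  · rw [hu, hv, hw]; rfl
  · intro x _ hx; rw [hw.proj_of_ne hx.symm]; simp
  · simp
  · intro x _ hx; simp [hv.proj_of_ne hx.symm]
  · simp
  · intro x _ hx; simp [hu.proj_of_ne hx.symm]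
  · simp

theorem assocInvLin_tmul {U V W : GVec ω} {a b c : G} {u : U.carrier} {v : V.carrier}
    {w : W.carrier} (hu : U.IsHom a u) (hv : V.IsHom b v) (hw : W.IsHom c w) :
    assocInvLin U V W (u ⊗ₜ[ℂ] (v ⊗ₜ[ℂ] w)) = ((ω a b c)⁻¹ : ℂ) • ((u ⊗ₜ[ℂ] v) ⊗ₜ[ℂ] w) := by
  simp only [assocInvLin, LinearMap.sum_apply, LinearMap.smul_apply, LinearMap.comp_apply,
    TensorProduct.map_tmul]
  rw [Finset.sum_eq_single a, Finset.sum_eq_single b, Finset.sum_eq_single c]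
  · rw [hu, hv, hw]; rfl
  · intro x _ hx; rw [hw.proj_of_ne hx.symm]; simp
  · simp
  · intro x _ hx; simp [hv.proj_of_ne hx.symm]
  · simp
  · intro x _ hx; simp [hu.proj_of_ne hx.symm]
  · simp

variable [DecidableEq G]

theorem IsHom.proj_eq {V : GVec ω} {g : G} {v : V.carrier} (hv : V.IsHom g v) (h : G) :
    V.proj h v = if g = h then v else 0 := by
  split_ifs with e
  · subst e; exact hv
  · exact hv.proj_of_ne e

theorem proj_comm_of_isHom {V X : GVec ω} {e : V.carrier →ₗ[ℂ] X.carrier} {g a : G}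
    {v : V.carrier} (hv : V.IsHom a v) (h : X.IsHom a (e v)) :
    X.proj g (e v) = e (V.proj g v) := by
  rw [h.proj_eq, hv.proj_eq, apply_ite e, map_zero]

theorem comm_single {V X : GVec ω} {e : V.carrier →ₗ[ℂ] X.carrier}
    (h : ∀ a v, V.IsHom a v → X.IsHom a (e v)) (g : G) (t : V.carrier) :
    X.proj g (e t) = e (V.proj g t) :=
  LinearMap.congr_fun (lin_ext (f := X.proj g ∘ₗ e) (g := e ∘ₗ V.proj g)
    fun a v hv => proj_comm_of_isHom hv (h a v hv)) t

theorem comm_tensor {V W X : GVec ω} {e : V.carrier ⊗[ℂ] W.carrier →ₗ[ℂ] X.carrier}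
    (h : ∀ a b v w, V.IsHom a v → W.IsHom b w → X.IsHom (a * b) (e (v ⊗ₜ[ℂ] w)))
    (g : G) (t : V.carrier ⊗[ℂ] W.carrier) : X.proj g (e t) = e ((tensorObj V W).proj g t) :=
  LinearMap.congr_fun (tensor_ext (f := X.proj g ∘ₗ e) (g := e ∘ₗ (tensorObj V W).proj g)
    fun a b v w hv hw => proj_comm_of_isHom (V := tensorObj V W) (hv.tmul hw) (h a b v w hv hw)) t

theorem comm_left {U V W X : GVec ω}
    {e : (U.carrier ⊗[ℂ] V.carrier) ⊗[ℂ] W.carrier →ₗ[ℂ] X.carrier}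
    (h : ∀ a b c u v w, U.IsHom a u → V.IsHom b v → W.IsHom c w →
      X.IsHom (a * b * c) (e ((u ⊗ₜ[ℂ] v) ⊗ₜ[ℂ] w)))
    (g : G) (t : (U.carrier ⊗[ℂ] V.carrier) ⊗[ℂ] W.carrier) :
    X.proj g (e t) = e ((tensorObj (tensorObj U V) W).proj g t) :=
  LinearMap.congr_fun (tensor_ext_left (f := X.proj g ∘ₗ e)
    (g := e ∘ₗ (tensorObj (tensorObj U V) W).proj g)
    fun a b c u v w hu hv hw => proj_comm_of_isHom (V := tensorObj (tensorObj U V) W)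
      ((hu.tmul hv).tmul hw) (h a b c u v w hu hv hw)) t

theorem comm_right {U V W X : GVec ω}
    {e : U.carrier ⊗[ℂ] (V.carrier ⊗[ℂ] W.carrier) →ₗ[ℂ] X.carrier}
    (h : ∀ a b c u v w, U.IsHom a u → V.IsHom b v → W.IsHom c w →
      X.IsHom (a * (b * c)) (e (u ⊗ₜ[ℂ] (v ⊗ₜ[ℂ] w))))
    (g : G) (t : U.carrier ⊗[ℂ] (V.carrier ⊗[ℂ] W.carrier)) :
    X.proj g (e t) = e ((tensorObj U (tensorObj V W)).proj g t) :=
  LinearMap.congr_fun (tensor_ext_right (f := X.proj g ∘ₗ e)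
    (g := e ∘ₗ (tensorObj U (tensorObj V W)).proj g)
    fun a b c u v w hu hv hw => proj_comm_of_isHom (V := tensorObj U (tensorObj V W))
      (hu.tmul (hv.tmul hw)) (h a b c u v w hu hv hw)) t

theorem IsHom.smul {V : GVec ω} {b : G} {v : V.carrier} (hv : V.IsHom b v) (z : ℂ) :
    V.IsHom b (z • v) := by
  rw [IsHom, map_smul, hv]

/-- The linear endomorphism of `V` acting on the component of degree `g` as the scalar `s g`. -/
def scale (V : GVec ω) (s : G → ℂ) : V.carrier →ₗ[ℂ] V.carrier := ∑ g, s g • V.proj g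

theorem IsHom.scale {V : GVec ω} {g : G} {v : V.carrier} (hv : V.IsHom g v) (s : G → ℂ) :
    V.scale s v = s g • v := by
  simp [GVec.scale, LinearMap.sum_apply, hv.proj_eq]

/-- The unit object: `ℂ` in degree `1`. -/
abbrev unitObj (ω : ThreeCocycle G) : GVec ω where
  carrier := ℂ
  proj g := if g = 1 then LinearMap.id else 0
  proj_proj g v := by split_ifs <;> simp
  proj_proj_of_ne g h v hgh := by
    split_ifs with h1 h2
    · exact absurd (h1.trans h2.symm) hgh
    all_goals simp
  sum_proj v := by simp [apply_ite (fun f : ℂ →ₗ[ℂ] ℂ => f v)]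

theorem isHom_unit (z : ℂ) : (unitObj ω).IsHom 1 z := by
  simp [IsHom, unitObj]

end GVec
end

noncomputable section

set_option linter.unusedSectionVars false
set_option linter.unusedVariables false

open CategoryTheory MonoidalCategory TensorProduct FrobeniusSchur

namespace ThreeCocycle

variable {G : Type} [Group G] (ω : ThreeCocycle G)

theorem cocycle_add (a b c d : G) :
    Additive.ofMul (ω b c d) + Additive.ofMul (ω a (b * c) d) + Additive.ofMul (ω a b c) -
      (Additive.ofMul (ω (a * b) c d) + Additive.ofMul (ω a b (c * d))) = 0 :=
  sub_eq_zero.2 (ω.cocycle a b c d)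

theorem triangle (a b : G) : ω a 1 b * (ω 1 1 b)⁻¹ = ω a 1 1 := by
  have h := ω.cocycle a 1 1 b
  simp only [mul_one, one_mul] at h
  rw [mul_inv_eq_iff_eq_mul]
  have h2 : ω a 1 b * (ω a 1 1 * ω 1 1 b) = ω a 1 b * ω a 1 b := by
    rw [← h]; ac_rfl
  exact (mul_left_cancel h2).symm

/-- The scalar by which the evaluation `V^∨ ⊗ V ⟶ 𝟙` differs from the naive pairing on `V_a`. It is
`ω(a, a⁻¹, a)⁻¹` if `ω` is normalized. -/
def evScalar (a : G) : ℂˣ := (ω a a⁻¹ a * ω 1 1 a * ω a 1 1)⁻¹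

theorem evScalar_zigzag (a : G) :
    (ω a a⁻¹ a)  * evScalar ω a = (ω 1 1 a)⁻¹ * (ω a 1 1)⁻¹ := by
  simp only [evScalar, mul_inv]
  rw [mul_assoc, mul_inv_cancel_left]

theorem evScalar_eq (a : G) :
    evScalar ω a = ω a⁻¹ a a⁻¹ * ω a⁻¹ 1 1 * ω 1 1 a⁻¹ := by
  apply Additive.ofMul.injective
  rw [← sub_eq_zero]
  have h1 := ω.cocycle_add a a⁻¹ a a⁻¹
  have h2 := ω.cocycle_add a a⁻¹ 1 1
  have h3 := ω.cocycle_add a 1 1 a⁻¹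
  have h4 := ω.cocycle_add 1 1 a a⁻¹
  have h5 := ω.cocycle_add 1 1 1 1
  simp only [mul_one, one_mul, mul_inv_cancel, inv_mul_cancel] at h1 h2 h3 h4 h5
  simp only [evScalar, ofMul_mul, ofMul_inv]
  generalize Additive.ofMul (ω a a⁻¹ a) = x1 at *
  have := congrArg₂ (· + ·) (congrArg₂ (· + ·) h1 h2) (congrArg₂ (· + ·) (congrArg₂ (· + ·) h3 h4)
    (congrArg (2 • ·) h5))
  simp only [add_zero, smul_zero] at this
  rw [← neg_eq_zero, ← this]
  abel

theorem evScalar_inv (a : G) : evScalar ω a⁻¹ = (evScalar ω a)⁻¹ := by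
  rw [evScalar_eq ω a, evScalar, inv_inv]
  congr 1
  ac_rfl

/-- The scalar relating the evaluation of `V ⊗ W` to the naive pairing on `V_a ⊗ W_b`. -/
def tensorScalar (a b : G) : ℂˣ :=
  ω b⁻¹ a⁻¹ (a * b) * (ω a⁻¹ a b)⁻¹ * evScalar ω a * (ω 1 1 b)⁻¹ * evScalar ω b

theorem tensorScalar_eq (a b : G) :
    tensorScalar ω a b * (evScalar ω (a * b))⁻¹ =
      evScalar ω a * evScalar ω b * tensorScalar ω b⁻¹ a⁻¹ := by
  simp only [tensorScalar]
  simp only [evScalar]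
  apply Additive.ofMul.injective
  rw [← sub_eq_zero]
  have r1 := ω.cocycle_add a a⁻¹ a a⁻¹
  have r2 := ω.cocycle_add a a⁻¹ a b
  have r3 := ω.cocycle_add a a⁻¹ 1 1
  have r4 := ω.cocycle_add a b (b⁻¹ * a⁻¹) (a * b)
  have r5 := ω.cocycle_add a b 1 1
  have r6 := ω.cocycle_add a 1 1 a⁻¹
  have r7 := ω.cocycle_add a 1 1 b
  have r8 := ω.cocycle_add b b⁻¹ a⁻¹ (a * b)
  have r9 := ω.cocycle_add b b⁻¹ b b⁻¹
  have r10 := ω.cocycle_add b b⁻¹ 1 1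
  have r11 := ω.cocycle_add b 1 1 b⁻¹
  have r12 := ω.cocycle_add 1 1 a⁻¹ (a * b)
  have r13 := ω.cocycle_add 1 1 a a⁻¹
  have r14 := ω.cocycle_add 1 1 a b
  have r15 := ω.cocycle_add 1 1 b b⁻¹
  have r16 := ω.cocycle_add 1 1 1 1
  simp only [mul_one, one_mul, mul_inv_cancel, inv_mul_cancel, mul_inv_cancel_left,
    inv_mul_cancel_left, mul_assoc, mul_inv_rev, inv_inv] at *
  simp only [ofMul_mul, ofMul_inv]
  have key := congrArg₂ (· + ·) (congrArg₂ (· + ·) (congrArg₂ (· - ·)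
    (congrArg₂ (· + ·) (congrArg₂ (· + ·) r1 r3) (congrArg₂ (· + ·) r6 r8))
    (congrArg₂ (· + ·) (congrArg₂ (· + ·) r2 r4) (congrArg₂ (· + ·) r5 r7)))
    (congrArg₂ (· + ·) (congrArg₂ (· + ·) r9 r10) (congrArg₂ (· + ·) r11 r12)))
    (congrArg₂ (· + ·) (congrArg₂ (· - ·) r13 r14) (congrArg₂ (· + ·) r15 (congrArg (4 • ·) r16)))
  simp only [add_zero, smul_zero, sub_zero] at key
  rw [← key]
  abel

end ThreeCocycle
end

noncomputable section

set_option linter.unusedSectionVars false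
set_option linter.unusedVariables false

open CategoryTheory MonoidalCategory TensorProduct FrobeniusSchur

namespace GVec

variable {G : Type} [Group G] [Fintype G] [DecidableEq G] {ω : ThreeCocycle G}

/-- The associativity isomorphism, `(u ⊗ v) ⊗ w ↦ ω(|u|, |v|, |w|) u ⊗ (v ⊗ w)`. -/
def assocIso (U V W : GVec ω) : tensorObj (tensorObj U V) W ≅ tensorObj U (tensorObj V W) where
  hom := ⟨assocLin U V W, comm_left fun a b c u v w hu hv hw => by
    rw [assocLin_tmul hu hv hw, mul_assoc]
    exact (hu.tmul (hv.tmul hw)).smul _⟩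
  inv := ⟨assocInvLin U V W, comm_right fun a b c u v w hu hv hw => by
    rw [assocInvLin_tmul hu hv hw, ← mul_assoc]
    exact ((hu.tmul hv).tmul hw).smul _⟩
  hom_inv_id := lin_injective (tensor_ext_left fun a b c u v w hu hv hw => by
    change assocInvLin U V W (assocLin U V W _) = _
    rw [assocLin_tmul hu hv hw, map_smul, assocInvLin_tmul hu hv hw, smul_smul]
    simp)
  inv_hom_id := lin_injective (tensor_ext_right fun a b c u v w hu hv hw => by
    change assocLin U V W (assocInvLin U V W _) = _
    rw [assocInvLin_tmul hu hv hw, map_smul, assocLin_tmul hu hv hw, smul_smul]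
    simp)

theorem isHom_one_tmul {V : GVec ω} {b : G} {v : V.carrier} (hv : V.IsHom b v) (z : ℂ) :
    (tensorObj (unitObj ω) V).IsHom b (z ⊗ₜ[ℂ] v) := by
  have := (isHom_unit (ω := ω) z).tmul hv
  rwa [one_mul] at this

theorem isHom_tmul_one {V : GVec ω} {b : G} {v : V.carrier} (hv : V.IsHom b v) (z : ℂ) :
    (tensorObj V (unitObj ω)).IsHom b (v ⊗ₜ[ℂ] z) := by
  have := hv.tmul (isHom_unit (ω := ω) z)
  rwa [mul_one] at this

theorem one_tmul_ext {V : GVec ω} {M : Type*} [AddCommGroup M] [Module ℂ M]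
    {f g : ℂ ⊗[ℂ] V.carrier →ₗ[ℂ] M}
    (h : ∀ b z v, V.IsHom b v → f (z ⊗ₜ[ℂ] v) = g (z ⊗ₜ[ℂ] v)) : f = g :=
  TensorProduct.ext (LinearMap.ext fun z => lin_ext fun b v hv => h b z v hv)

theorem tmul_one_ext {V : GVec ω} {M : Type*} [AddCommGroup M] [Module ℂ M]
    {f g : V.carrier ⊗[ℂ] ℂ →ₗ[ℂ] M}
    (h : ∀ b z v, V.IsHom b v → f (v ⊗ₜ[ℂ] z) = g (v ⊗ₜ[ℂ] z)) : f = g :=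
  TensorProduct.ext (lin_ext fun b v hv => LinearMap.ext fun z => h b z v hv)

theorem comm_one_tmul {V X : GVec ω} {e : ℂ ⊗[ℂ] V.carrier →ₗ[ℂ] X.carrier}
    (h : ∀ b z v, V.IsHom b v → X.IsHom b (e (z ⊗ₜ[ℂ] v)))
    (g : G) (t : ℂ ⊗[ℂ] V.carrier) : X.proj g (e t) = e ((tensorObj (unitObj ω) V).proj g t) :=
  LinearMap.congr_fun (one_tmul_ext (f := X.proj g ∘ₗ e)
    (g := e ∘ₗ (tensorObj (unitObj ω) V).proj g) fun b z v hv =>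
    proj_comm_of_isHom (V := tensorObj (unitObj ω) V) (isHom_one_tmul hv z) (h b z v hv)) t

theorem comm_tmul_one {V X : GVec ω} {e : V.carrier ⊗[ℂ] ℂ →ₗ[ℂ] X.carrier}
    (h : ∀ b z v, V.IsHom b v → X.IsHom b (e (v ⊗ₜ[ℂ] z)))
    (g : G) (t : V.carrier ⊗[ℂ] ℂ) : X.proj g (e t) = e ((tensorObj V (unitObj ω)).proj g t) :=
  LinearMap.congr_fun (tmul_one_ext (f := X.proj g ∘ₗ e)
    (g := e ∘ₗ (tensorObj V (unitObj ω)).proj g) fun b z v hv =>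
    proj_comm_of_isHom (V := tensorObj V (unitObj ω)) (isHom_tmul_one hv z) (h b z v hv)) t

/-- The left unit isomorphism, `z ⊗ v ↦ ω(1, 1, |v|)⁻¹ z v`; it is the obvious one if `ω` is
normalized. -/
def leftUnitIso (V : GVec ω) : tensorObj (unitObj ω) V ≅ V where
  hom := ⟨V.scale (fun a => ((ω 1 1 a)⁻¹ : ℂ)) ∘ₗ (TensorProduct.lid ℂ V.carrier).toLinearMap,
    comm_one_tmul fun b z v hv => by
      simpa [hv.scale] using (hv.smul _).smul _⟩
  inv := ⟨(TensorProduct.lid ℂ V.carrier).symm.toLinearMap ∘ₗ V.scale (fun a => (ω 1 1 a : ℂ)),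
    comm_single fun b v hv => by
      simpa [hv.scale] using (isHom_one_tmul hv 1).smul _⟩
  hom_inv_id := lin_injective (one_tmul_ext fun b z v hv => by
    change (TensorProduct.lid ℂ V.carrier).symm (V.scale _ (V.scale _ (z • v))) = z ⊗ₜ[ℂ] v
    simp [hv.scale, TensorProduct.smul_tmul'])
  inv_hom_id := lin_injective (lin_ext fun b v hv => by
    change V.scale _ ((TensorProduct.lid ℂ V.carrier)
      ((TensorProduct.lid ℂ V.carrier).symm (V.scale _ v))) = v
    simp [hv.scale])

/-- The right unit isomorphism, `v ⊗ z ↦ ω(|v|, 1, 1) z v`; it is the obvious one if `ω` is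
normalized. -/
def rightUnitIso (V : GVec ω) : tensorObj V (unitObj ω) ≅ V where
  hom := ⟨V.scale (fun a => (ω a 1 1 : ℂ)) ∘ₗ (TensorProduct.rid ℂ V.carrier).toLinearMap,
    comm_tmul_one fun b z v hv => by
      simpa [hv.scale] using (hv.smul _).smul _⟩
  inv := ⟨(TensorProduct.rid ℂ V.carrier).symm.toLinearMap ∘ₗ
      V.scale (fun a => ((ω a 1 1)⁻¹ : ℂ)),
    comm_single fun b v hv => by
      simpa [hv.scale] using (isHom_tmul_one hv 1).smul _⟩
  hom_inv_id := lin_injective (tmul_one_ext fun b z v hv => by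
    change (TensorProduct.rid ℂ V.carrier).symm (V.scale _ (V.scale _ (z • v))) = v ⊗ₜ[ℂ] z
    simp only [map_smul, hv.scale, smul_smul, TensorProduct.rid_symm_apply]
    rw [← TensorProduct.tmul_smul, smul_eq_mul, mul_one]
    simp)
  inv_hom_id := lin_injective (lin_ext fun b v hv => by
    change V.scale _ ((TensorProduct.rid ℂ V.carrier)
      ((TensorProduct.rid ℂ V.carrier).symm (V.scale _ v))) = v
    simp [hv.scale])

/-- The tensor product of two morphisms. -/
def tensorMap {V V' W W' : GVec ω} (f : V ⟶ V') (g : W ⟶ W') :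
    tensorObj V W ⟶ tensorObj V' W' :=
  ⟨TensorProduct.map (lin f) (lin g), comm_tensor fun a b v w hv hw => by
    rw [TensorProduct.map_tmul]
    exact (hv.lin f).tmul (hw.lin g)⟩

instance : MonoidalCategoryStruct (GVec ω) where
  tensorObj := tensorObj
  whiskerLeft V _ _ f := tensorMap (𝟙 V) f
  whiskerRight f W := tensorMap f (𝟙 W)
  tensorHom f g := tensorMap f g
  tensorUnit := unitObj ω
  associator := assocIso
  leftUnitor := leftUnitIso
  rightUnitor := rightUnitIso

theorem lin_tensorHom_tmul {V V' W W' : GVec ω} (f : V ⟶ V') (g : W ⟶ W') (v : V.carrier)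
    (w : W.carrier) : lin (f ⊗ₘ g) (v ⊗ₜ[ℂ] w) = lin f v ⊗ₜ[ℂ] lin g w := rfl

theorem lin_whiskerLeft_tmul (V : GVec ω) {W W' : GVec ω} (g : W ⟶ W') (v : V.carrier)
    (w : W.carrier) : lin (V ◁ g) (v ⊗ₜ[ℂ] w) = v ⊗ₜ[ℂ] lin g w := rfl

theorem lin_whiskerRight_tmul {V V' : GVec ω} (f : V ⟶ V') (W : GVec ω) (v : V.carrier)
    (w : W.carrier) : lin (f ▷ W) (v ⊗ₜ[ℂ] w) = lin f v ⊗ₜ[ℂ] w := rfl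

theorem lin_associator_hom {U V W : GVec ω} {a b c : G} {u : U.carrier} {v : V.carrier}
    {w : W.carrier} (hu : U.IsHom a u) (hv : V.IsHom b v) (hw : W.IsHom c w) :
    lin (α_ U V W).hom ((u ⊗ₜ[ℂ] v) ⊗ₜ[ℂ] w) = (ω a b c : ℂ) • (u ⊗ₜ[ℂ] (v ⊗ₜ[ℂ] w)) :=
  assocLin_tmul hu hv hw

theorem lin_associator_inv {U V W : GVec ω} {a b c : G} {u : U.carrier} {v : V.carrier}
    {w : W.carrier} (hu : U.IsHom a u) (hv : V.IsHom b v) (hw : W.IsHom c w) :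
    lin (α_ U V W).inv (u ⊗ₜ[ℂ] (v ⊗ₜ[ℂ] w)) = ((ω a b c)⁻¹ : ℂ) • ((u ⊗ₜ[ℂ] v) ⊗ₜ[ℂ] w) :=
  assocInvLin_tmul hu hv hw

theorem lin_leftUnitor_hom {V : GVec ω} {a : G} (z : ℂ) {v : V.carrier} (hv : V.IsHom a v) :
    lin (λ_ V).hom (z ⊗ₜ[ℂ] v) = ((ω 1 1 a)⁻¹ : ℂ) • z • v := by
  change V.scale _ (z • v) = _
  rw [(hv.smul z).scale]

theorem lin_leftUnitor_inv {V : GVec ω} {a : G} {v : V.carrier} (hv : V.IsHom a v) :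
    lin (λ_ V).inv v = (ω 1 1 a : ℂ) • ((1 : ℂ) ⊗ₜ[ℂ] v) := by
  change (TensorProduct.lid ℂ V.carrier).symm (V.scale _ v) = _
  rw [hv.scale, map_smul]; rfl

theorem lin_rightUnitor_hom {V : GVec ω} {a : G} (z : ℂ) {v : V.carrier} (hv : V.IsHom a v) :
    lin (ρ_ V).hom (v ⊗ₜ[ℂ] z) = (ω a 1 1 : ℂ) • z • v := by
  change V.scale _ (z • v) = _
  rw [(hv.smul z).scale]

theorem lin_rightUnitor_inv {V : GVec ω} {a : G} {v : V.carrier} (hv : V.IsHom a v) :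
    lin (ρ_ V).inv v = ((ω a 1 1)⁻¹ : ℂ) • (v ⊗ₜ[ℂ] (1 : ℂ)) := by
  change (TensorProduct.rid ℂ V.carrier).symm (V.scale _ v) = _
  rw [hv.scale, map_smul]; rfl

theorem lin_comp_apply {U V W : GVec ω} (f : U ⟶ V) (g : V ⟶ W) (u : U.carrier) :
    lin (f ≫ g) u = lin g (lin f u) := rfl

theorem lin_id_apply (V : GVec ω) (v : V.carrier) : lin (𝟙 V) v = v := rfl

theorem tensor_ext_four {U V W X : GVec ω} {M : Type*} [AddCommGroup M] [Module ℂ M]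
    {f g : ((U.carrier ⊗[ℂ] V.carrier) ⊗[ℂ] W.carrier) ⊗[ℂ] X.carrier →ₗ[ℂ] M}
    (h : ∀ a b c d u v w x, U.IsHom a u → V.IsHom b v → W.IsHom c w → X.IsHom d x →
      f (((u ⊗ₜ[ℂ] v) ⊗ₜ[ℂ] w) ⊗ₜ[ℂ] x) = g (((u ⊗ₜ[ℂ] v) ⊗ₜ[ℂ] w) ⊗ₜ[ℂ] x)) : f = g :=
  TensorProduct.ext (tensor_ext_left fun a b c u v w hu hv hw => lin_ext fun d x hx =>
    h a b c d u v w x hu hv hw hx)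

instance : MonoidalCategory (GVec ω) where
  tensorHom_def f g := lin_injective (TensorProduct.ext' fun v w => rfl)
  id_tensorHom_id V W := lin_injective (TensorProduct.ext' fun v w => rfl)
  tensorHom_comp_tensorHom f g f' g' := lin_injective (TensorProduct.ext' fun v w => rfl)
  whiskerLeft_id V W := lin_injective (TensorProduct.ext' fun v w => rfl)
  id_whiskerRight V W := lin_injective (TensorProduct.ext' fun v w => rfl)
  associator_naturality f g h := lin_injective (tensor_ext_left fun a b c u v w hu hv hw => by
    rw [lin_comp_apply, lin_comp_apply, lin_associator_hom hu hv hw, map_smul]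
    exact lin_associator_hom (hu.lin f) (hv.lin g) (hw.lin h))
  leftUnitor_naturality {V W} f := lin_injective (one_tmul_ext fun b z v hv => by
    rw [lin_comp_apply, lin_comp_apply, lin_leftUnitor_hom z hv, map_smul, map_smul]
    exact lin_leftUnitor_hom z (hv.lin f))
  rightUnitor_naturality {V W} f := lin_injective (tmul_one_ext fun b z v hv => by
    rw [lin_comp_apply, lin_comp_apply, lin_rightUnitor_hom z hv, map_smul, map_smul]
    exact lin_rightUnitor_hom z (hv.lin f))
  pentagon U V W X := lin_injective (tensor_ext_four fun a b c d u v w x hu hv hw hx => by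
    have h1 : lin ((α_ U V W).hom ▷ X) (((u ⊗ₜ[ℂ] v) ⊗ₜ[ℂ] w) ⊗ₜ[ℂ] x) =
        (ω a b c : ℂ) • ((u ⊗ₜ[ℂ] (v ⊗ₜ[ℂ] w)) ⊗ₜ[ℂ] x) := by
      rw [lin_whiskerRight_tmul, lin_associator_hom hu hv hw]; rfl
    have h2 : lin (U ◁ (α_ V W X).hom) (u ⊗ₜ[ℂ] ((v ⊗ₜ[ℂ] w) ⊗ₜ[ℂ] x)) =
        (ω b c d : ℂ) • (u ⊗ₜ[ℂ] (v ⊗ₜ[ℂ] (w ⊗ₜ[ℂ] x))) := by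
      rw [lin_whiskerLeft_tmul, lin_associator_hom hv hw hx]
      exact TensorProduct.tmul_smul _ _ _
    have h3 := lin_associator_hom hu (hv.tmul hw) hx
    have h4 := lin_associator_hom (hu.tmul hv) hw hx
    have h5 := lin_associator_hom hu hv (hw.tmul hx)
    rw [lin_comp_apply, lin_comp_apply, lin_comp_apply, h1, map_smul, map_smul]
    erw [h3, h4]
    rw [map_smul, map_smul]
    erw [h2, h5]
    rw [smul_smul, smul_smul, smul_smul]
    congr 1
    have := congrArg (Units.val) (ω.cocycle a b c d)
    push_cast at this
    rw [← this]; ring)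
  triangle V W := lin_injective (TensorProduct.ext (tmul_one_ext fun a z v hv =>
      lin_ext fun b w hw => by
    change lin ((α_ V (𝟙_ (GVec ω)) W).hom ≫ V ◁ (λ_ W).hom) ((v ⊗ₜ[ℂ] z) ⊗ₜ[ℂ] w) =
      lin ((ρ_ V).hom ▷ W) ((v ⊗ₜ[ℂ] z) ⊗ₜ[ℂ] w)
    have h1 := lin_associator_hom (V := unitObj ω) hv (isHom_unit z) hw
    rw [lin_comp_apply]
    erw [h1]
    rw [map_smul]
    erw [lin_whiskerLeft_tmul, lin_whiskerRight_tmul]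
    rw [lin_leftUnitor_hom z hw, lin_rightUnitor_hom z hv, TensorProduct.tmul_smul,
      TensorProduct.tmul_smul, TensorProduct.smul_tmul', TensorProduct.smul_tmul', smul_smul,
      ← ω.triangle a b]
    push_cast
    rw [TensorProduct.smul_tmul', smul_smul, smul_smul, mul_assoc]))

instance : MonoidalPreadditive (GVec ω) where
  whiskerLeft_zero := lin_injective (TensorProduct.ext' fun v w => TensorProduct.tmul_zero _ _)
  zero_whiskerRight := lin_injective (TensorProduct.ext' fun v w => TensorProduct.zero_tmul _ _)
  whiskerLeft_add f g :=
    lin_injective (TensorProduct.ext' fun v w => TensorProduct.tmul_add _ _ _)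
  add_whiskerRight f g :=
    lin_injective (TensorProduct.ext' fun v w => TensorProduct.add_tmul _ _ _)

instance : MonoidalLinear ℂ (GVec ω) where
  whiskerLeft_smul _ _ _ _ _ :=
    lin_injective (TensorProduct.ext' fun v w => TensorProduct.tmul_smul _ _ _)
  smul_whiskerRight _ _ _ _ _ :=
    lin_injective (TensorProduct.ext' fun v w => rfl)

end GVec
end

noncomputable section

set_option linter.unusedSectionVars false
set_option linter.unusedVariables false

open CategoryTheory MonoidalCategory TensorProduct FrobeniusSchur ThreeCocycle

namespace GVec

variable {G : Type} [Group G] [Fintype G] [DecidableEq G] {ω : ThreeCocycle G}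

/-- The dual space, with `(V^∨)_g = (V_{g⁻¹})^*`. -/
abbrev dualObj (V : GVec ω) : GVec ω where
  carrier := Module.Dual ℂ V.carrier
  proj g := (V.proj g⁻¹).dualMap
  proj_proj g φ := by ext v; simp [V.proj_proj]
  proj_proj_of_ne g h φ hgh := by
    ext v
    simp [V.proj_proj_of_ne h⁻¹ g⁻¹ v (by simpa using hgh.symm)]
  sum_proj φ := by
    ext v
    simp only [LinearMap.sum_apply, LinearMap.dualMap_apply]
    rw [← map_sum]
    congr 1
    exact (Equiv.sum_comp (Equiv.inv G) fun g => V.proj g v).trans (V.sum_proj v)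

theorem dual_apply_eq_zero {V : GVec ω} {a b : G} {φ : Module.Dual ℂ V.carrier} {v : V.carrier}
    (hφ : V.dualObj.IsHom b φ) (hv : V.IsHom a v) (h : b * a ≠ 1) : φ v = 0 := by
  rw [← hφ]
  change φ (V.proj b⁻¹ v) = 0
  rw [hv.proj_of_ne (fun e => h (by rw [e, mul_inv_cancel])), map_zero]

/-- The linear map `V^* ⊗ V → ℂ`, `φ ⊗ v ↦ e(|v|) φ(v)` with `e = evScalar ω`. -/
def evLin (V : GVec ω) : Module.Dual ℂ V.carrier ⊗[ℂ] V.carrier →ₗ[ℂ] ℂ :=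
  contractLeft ℂ V.carrier ∘ₗ
    TensorProduct.map LinearMap.id (V.scale fun a => (evScalar ω a : ℂ))

theorem evLin_tmul {V : GVec ω} {a : G} (φ : Module.Dual ℂ V.carrier) {v : V.carrier}
    (hv : V.IsHom a v) : evLin V (φ ⊗ₜ[ℂ] v) = (evScalar ω a : ℂ) * φ v := by
  simp [evLin, hv.scale]

/-- Contraction of `V ⊗ V^*` against a vector. -/
def contractVec (V : GVec ω) (v : V.carrier) :
    V.carrier ⊗[ℂ] Module.Dual ℂ V.carrier →ₗ[ℂ] V.carrier :=
  TensorProduct.lift (LinearMap.flip (LinearMap.lsmul ℂ V.carrier ∘ₗ Module.Dual.eval ℂ V.carrier v))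

theorem contractVec_tmul (V : GVec ω) (v u : V.carrier) (φ : Module.Dual ℂ V.carrier) :
    contractVec V v (u ⊗ₜ[ℂ] φ) = φ v • u := rfl

theorem contractVec_coevaluation (V : GVec ω) (z : ℂ) (v : V.carrier) :
    contractVec V v (coevaluation ℂ V.carrier z) = z • v := by
  have : (coevaluation ℂ V.carrier z) = z • coevaluation ℂ V.carrier 1 := by
    rw [← map_smul]; simp
  rw [this, map_smul, coevaluation_apply_one, map_sum]
  congr 1
  simp only [contractVec_tmul]
  exact (Module.Basis.ofVectorSpace ℂ V.carrier).sum_repr v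

theorem contractVec_injective {V : GVec ω} {x y : V.carrier ⊗[ℂ] Module.Dual ℂ V.carrier}
    (h : ∀ v, contractVec V v x = contractVec V v y) : x = y := by
  apply (TensorProduct.comm ℂ V.carrier (Module.Dual ℂ V.carrier)).injective
  apply (dualTensorHomEquiv ℂ V.carrier V.carrier).injective
  have key : ∀ (t : V.carrier ⊗[ℂ] Module.Dual ℂ V.carrier) (v : V.carrier),
      dualTensorHomEquiv ℂ V.carrier V.carrier (TensorProduct.comm ℂ _ _ t) v =
        contractVec V v t := by
    intro t v
    induction t using TensorProduct.induction_on with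
    | zero => simp
    | add x y hx hy => simp only [map_add, LinearMap.add_apply, hx, hy]
    | tmul u φ => simp [contractVec_tmul]
  ext v
  rw [key, key, h]

theorem contractVec_proj (V : GVec ω) (g : G) (v : V.carrier)
    (t : V.carrier ⊗[ℂ] Module.Dual ℂ V.carrier) :
    contractVec V v ((tensorObj V V.dualObj).proj g t) =
      ∑ h, V.proj h (contractVec V (V.proj (g⁻¹ * h) v) t) := by
  induction t using TensorProduct.induction_on with
  | zero => simp
  | add x y hx hy => simp only [map_add, hx, hy, Finset.sum_add_distrib]
  | tmul u φ =>
    change contractVec V v ((∑ h, TensorProduct.map (V.proj h) (V.dualObj.proj (h⁻¹ * g))) _) = _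
    simp only [LinearMap.sum_apply, TensorProduct.map_tmul, map_sum, contractVec_tmul, map_smul]
    refine Finset.sum_congr rfl fun h _ => ?_
    congr 1
    simp [LinearMap.dualMap_apply]

/-- The evaluation `V^∨ ⊗ V ⟶ 𝟙`, `φ ⊗ v ↦ e(|v|) φ(v)`. -/
def evMor (V : GVec ω) : V.dualObj ⊗ V ⟶ 𝟙_ (GVec ω) :=
  ⟨evLin V, comm_tensor (X := unitObj ω) fun b a φ v hφ hv => by
    rw [evLin_tmul φ hv]
    by_cases h : b * a = 1
    · rw [h]; exact isHom_unit _
    · rw [dual_apply_eq_zero hφ hv h, mul_zero]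
      exact map_zero _⟩

/-- The coevaluation `𝟙 ⟶ V ⊗ V^∨`, `1 ↦ ∑ᵢ vᵢ ⊗ vⁱ`. -/
def coevMor (V : GVec ω) : 𝟙_ (GVec ω) ⟶ V ⊗ V.dualObj :=
  ⟨coevaluation ℂ V.carrier, fun g (z : ℂ) => contractVec_injective fun v => by
    refine (contractVec_proj V g v _).trans ?_
    have h1 : contractVec V v (coevaluation ℂ V.carrier ((unitObj ω).proj g z)) =
        (if g = 1 then z else 0) • v := by
      rw [contractVec_coevaluation]
      simp only [unitObj]
      split_ifs <;> rfl
    have h2 : ∀ h, V.proj h (contractVec V (V.proj (g⁻¹ * h) v) (coevaluation ℂ V.carrier z)) =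
        (if g = 1 then z else 0) • V.proj h v := fun h => by
      rw [contractVec_coevaluation, map_smul]
      split_ifs with hg
      · rw [hg, inv_one, one_mul, V.proj_proj]
      · rw [V.proj_proj_of_ne _ _ _ (by simpa using hg), smul_zero, zero_smul]
    refine Eq.trans ?_ h1.symm
    refine (Finset.sum_congr rfl fun h _ => h2 h).trans ?_
    rw [← Finset.smul_sum, V.sum_proj]⟩

theorem lin_evMor {V : GVec ω} {a : G} (φ : Module.Dual ℂ V.carrier) {v : V.carrier}
    (hv : V.IsHom a v) : lin (evMor V) (φ ⊗ₜ[ℂ] v) = (evScalar ω a : ℂ) * φ v :=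
  evLin_tmul φ hv

/-- First zigzag, with the coevaluation tensor replaced by an arbitrary one. -/
theorem zigzag_one {V : GVec ω} {c : G} {v : V.carrier} (hv : V.IsHom c v)
    (t : V.carrier ⊗[ℂ] Module.Dual ℂ V.carrier) :
    lin ((α_ V V.dualObj V).hom ≫ V ◁ evMor V) (t ⊗ₜ[ℂ] v) =
      V.scale (fun a => (ω a c⁻¹ c : ℂ) * evScalar ω c) (contractVec V v t) ⊗ₜ[ℂ] (1 : ℂ) := by
  refine LinearMap.congr_fun (f := lin ((α_ V V.dualObj V).hom ≫ V ◁ evMor V) ∘ₗ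
      (TensorProduct.mk ℂ _ _).flip v)
    (g := (TensorProduct.mk ℂ _ _).flip (1 : ℂ) ∘ₗ
      V.scale (fun a => (ω a c⁻¹ c : ℂ) * evScalar ω c) ∘ₗ contractVec V v)
    (tensor_ext (V := V) (W := V.dualObj) fun a b u φ hu hφ => ?_) t
  change lin (V ◁ evMor V) (lin (α_ V V.dualObj V).hom ((u ⊗ₜ[ℂ] φ) ⊗ₜ[ℂ] v)) =
    V.scale (fun a => (ω a c⁻¹ c : ℂ) * evScalar ω c) (φ v • u) ⊗ₜ[ℂ] (1 : ℂ)
  rw [lin_associator_hom hu hφ hv, map_smul]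
  erw [lin_whiskerLeft_tmul]
  rw [lin_evMor φ hv, (hu.smul _).scale]
  by_cases h : b * c = 1
  · obtain rfl : b = c⁻¹ := eq_inv_of_mul_eq_one_left h
    rw [← TensorProduct.smul_tmul', ← TensorProduct.smul_tmul']
    rw [← mul_one ((evScalar ω c : ℂ) * φ v), ← smul_eq_mul (_ * _) (1 : ℂ)]
    erw [TensorProduct.tmul_smul]
    rw [smul_smul, smul_smul]
    congr 1
    ring
  · rw [dual_apply_eq_zero hφ hv h]
    simp

/-- Contraction of `V ⊗ V^*` against a functional. -/
def contractDual (V : GVec ω) (φ : Module.Dual ℂ V.carrier) :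
    V.carrier ⊗[ℂ] Module.Dual ℂ V.carrier →ₗ[ℂ] Module.Dual ℂ V.carrier :=
  TensorProduct.lift (LinearMap.lsmul ℂ (Module.Dual ℂ V.carrier) ∘ₗ φ)

theorem contractDual_tmul (V : GVec ω) (u : V.carrier) (φ ψ : Module.Dual ℂ V.carrier) :
    contractDual V φ (u ⊗ₜ[ℂ] ψ) = φ u • ψ := rfl

theorem contractDual_apply (V : GVec ω) (φ : Module.Dual ℂ V.carrier)
    (t : V.carrier ⊗[ℂ] Module.Dual ℂ V.carrier) (v : V.carrier) :
    contractDual V φ t v = φ (contractVec V v t) := by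
  induction t using TensorProduct.induction_on with
  | zero => simp
  | add x y hx hy => simp only [map_add, LinearMap.add_apply, hx, hy]
  | tmul u ψ => simp [contractVec_tmul, contractDual_tmul, mul_comm]

theorem contractDual_coevaluation (V : GVec ω) (φ : Module.Dual ℂ V.carrier) :
    contractDual V φ (coevaluation ℂ V.carrier 1) = φ := by
  ext v
  rw [contractDual_apply, contractVec_coevaluation, one_smul]

theorem zigzag_two {V : GVec ω} {b : G} {φ : Module.Dual ℂ V.carrier} (hφ : V.dualObj.IsHom b φ)
    (t : V.carrier ⊗[ℂ] Module.Dual ℂ V.carrier) :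
    lin ((α_ V.dualObj V V.dualObj).inv ≫ evMor V ▷ V.dualObj) (φ ⊗ₜ[ℂ] t) =
      (1 : ℂ) ⊗ₜ[ℂ] V.dualObj.scale (fun d => ((ω b b⁻¹ d)⁻¹ : ℂ) * evScalar ω b⁻¹)
        (contractDual V φ t) := by
  refine LinearMap.congr_fun (f := lin ((α_ V.dualObj V V.dualObj).inv ≫ evMor V ▷ V.dualObj) ∘ₗ
      (TensorProduct.mk ℂ _ _) φ)
    (g := (TensorProduct.mk ℂ _ _) (1 : ℂ) ∘ₗ
      V.dualObj.scale (fun d => ((ω b b⁻¹ d)⁻¹ : ℂ) * evScalar ω b⁻¹) ∘ₗ contractDual V φ)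
    (tensor_ext (V := V) (W := V.dualObj) fun a d u ψ hu hψ => ?_) t
  change lin (evMor V ▷ V.dualObj) (lin (α_ V.dualObj V V.dualObj).inv (φ ⊗ₜ[ℂ] (u ⊗ₜ[ℂ] ψ))) =
    (1 : ℂ) ⊗ₜ[ℂ] V.dualObj.scale (fun d => ((ω b b⁻¹ d)⁻¹ : ℂ) * evScalar ω b⁻¹) (φ u • ψ)
  rw [lin_associator_inv hφ hu hψ, map_smul]
  erw [lin_whiskerRight_tmul]
  rw [lin_evMor φ hu, (hψ.smul _).scale]
  by_cases h : b * a = 1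
  · obtain rfl : a = b⁻¹ := eq_inv_of_mul_eq_one_right h
    rw [TensorProduct.tmul_smul, TensorProduct.tmul_smul]
    rw [← mul_one ((evScalar ω b⁻¹ : ℂ) * φ u), ← smul_eq_mul (_ * _) (1 : ℂ)]
    erw [← TensorProduct.smul_tmul']
    rw [smul_smul, smul_smul]
    congr 1
    ring
  · rw [dual_apply_eq_zero hφ hu h]
    simp

instance (V : GVec ω) : ExactPairing V V.dualObj where
  coevaluation' := coevMor V
  evaluation' := evMor V
  coevaluation_evaluation' := lin_injective (tmul_one_ext (V := V.dualObj) fun b z φ hφ => by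
    have h : φ ⊗ₜ[ℂ] z = z • (φ ⊗ₜ[ℂ] (1 : ℂ)) := by
      rw [← TensorProduct.tmul_smul, smul_eq_mul, mul_one]
    rw [h, map_smul, map_smul]
    congr 1
    refine (zigzag_two hφ _).trans ?_
    have hc : contractDual V φ (lin (coevMor V) (1 : ℂ)) = φ := contractDual_coevaluation V φ
    rw [hc, hφ.scale, TensorProduct.tmul_smul, lin_comp_apply]
    erw [lin_rightUnitor_hom 1 hφ]
    rw [one_smul, map_smul, lin_leftUnitor_inv hφ, smul_smul]
    congr 1
    have := congrArg Units.val (evScalar_eq ω b⁻¹)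
    rw [this]
    push_cast
    rw [inv_inv]
    field_simp)
  evaluation_coevaluation' := lin_injective (one_tmul_ext (V := V) fun b z v hv => by
    have h : z ⊗ₜ[ℂ] v = z • ((1 : ℂ) ⊗ₜ[ℂ] v) := by
      rw [TensorProduct.smul_tmul', smul_eq_mul, mul_one]
    rw [h, map_smul, map_smul]
    congr 1
    refine (zigzag_one hv _).trans ?_
    have hc : contractVec V v (lin (coevMor V) (1 : ℂ)) = v :=
      (contractVec_coevaluation V 1 v).trans (one_smul _ _)
    rw [hc, hv.scale, ← TensorProduct.smul_tmul', lin_comp_apply]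
    erw [lin_leftUnitor_hom 1 hv]
    rw [one_smul, map_smul, lin_rightUnitor_inv hv, smul_smul]
    congr 1
    have := congrArg Units.val (evScalar_eq ω b⁻¹)
    have h2 := congrArg Units.val (evScalar_zigzag ω b)
    push_cast at h2
    exact h2)

instance : RightRigidCategory (GVec ω) where
  rightDual V := ⟨V.dualObj⟩

theorem dual_eq (V : GVec ω) : dual V = V.dualObj := rfl

theorem lin_evaluation {V : GVec ω} {a : G} (φ : Module.Dual ℂ V.carrier) {v : V.carrier}
    (hv : V.IsHom a v) :
    lin (ε_ V (dual V)) (φ ⊗ₜ[ℂ] v) = (evScalar ω a : ℂ) * φ v := evLin_tmul φ hv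

theorem lin_coevaluation (V : GVec ω) (z : ℂ) :
    lin (η_ V (dual V)) z = coevaluation ℂ V.carrier z := rfl

theorem lin_dualMap {V W : GVec ω} (f : V ⟶ W) : lin (dualMap f) = (lin f).dualMap := by
  refine LinearMap.ext fun (φ : Module.Dual ℂ W.carrier) => lin_ext fun a v hv => ?_
  have h := LinearMap.congr_fun (congrArg lin (rightAdjointMate_comp_evaluation f))
    ((show (dual W).carrier from φ) ⊗ₜ[ℂ] v)
  have h1 : lin (dualMap f ▷ V ≫ ε_ V (dual V)) ((show (dual W).carrier from φ) ⊗ₜ[ℂ] v) =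
      (evScalar ω a : ℂ) * (show Module.Dual ℂ V.carrier from lin (dualMap f) φ) v :=
    lin_evaluation (V := V) (lin (dualMap f) φ) hv
  have h2 : lin (dual W ◁ f ≫ ε_ W (dual W)) ((show (dual W).carrier from φ) ⊗ₜ[ℂ] v) =
      (evScalar ω a : ℂ) * φ (lin f v) :=
    lin_evaluation (V := W) φ (hv.lin f)
  exact mul_left_cancel₀ (Units.ne_zero _) (h1.symm.trans (h.trans h2))

theorem isHom_eval {V : GVec ω} {a : G} {v : V.carrier} (hv : V.IsHom a v) :
    (dual (dual V)).IsHom a (Module.Dual.eval ℂ V.carrier v) := by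
  change (V.proj a⁻¹⁻¹).dualMap.dualMap (Module.Dual.eval ℂ V.carrier v) = _
  ext φ
  have : V.proj a v = v := hv
  simp [this]

/-- The pivotal isomorphism `V ≅ V^∨∨`: on `V_a` it is `e(a)` times the canonical map to the
bidual. -/
def pivotalIso (V : GVec ω) : V ≅ dual (dual V) where
  hom := ⟨Module.Dual.eval ℂ V.carrier ∘ₗ V.scale (fun a => (evScalar ω a : ℂ)),
    comm_single (X := dual (dual V)) fun a v hv => by
      rw [LinearMap.comp_apply, hv.scale, map_smul]
      exact (isHom_eval hv).smul _⟩
  inv := ⟨V.scale (fun a => ((evScalar ω a)⁻¹ : ℂ)) ∘ₗ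
      (Module.evalEquiv ℂ V.carrier).symm.toLinearMap, fun g x => by
    obtain ⟨v, rfl⟩ := (Module.evalEquiv ℂ V.carrier).surjective x
    have h : (dual (dual V)).proj g (Module.evalEquiv ℂ V.carrier v) =
        Module.evalEquiv ℂ V.carrier (V.proj g v) :=
      (comm_single (X := dual (dual V)) (e := Module.Dual.eval ℂ V.carrier)
        (fun a v hv => isHom_eval hv) g v)
    rw [h]
    simp only [LinearMap.comp_apply, LinearEquiv.coe_coe, LinearEquiv.symm_apply_apply]
    exact comm_single (fun a v hv => by rw [hv.scale]; exact hv.smul _) g v⟩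
  hom_inv_id := lin_injective (lin_ext fun a v hv => by
    change V.scale _ ((Module.evalEquiv ℂ V.carrier).symm
      (Module.evalEquiv ℂ V.carrier (V.scale _ v))) = v
    rw [LinearEquiv.symm_apply_apply, hv.scale, map_smul, hv.scale, smul_smul]
    simp)
  inv_hom_id := lin_injective (LinearMap.ext fun x => by
    obtain ⟨v, rfl⟩ := (Module.evalEquiv ℂ V.carrier).surjective x
    change Module.evalEquiv ℂ V.carrier (V.scale _ (V.scale _ ((Module.evalEquiv ℂ V.carrier).symm
      (Module.evalEquiv ℂ V.carrier v)))) = Module.evalEquiv ℂ V.carrier v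
    rw [LinearEquiv.symm_apply_apply]
    congr 1
    refine LinearMap.congr_fun (f := V.scale _ ∘ₗ V.scale _) (g := LinearMap.id)
      (lin_ext fun a v hv => ?_) v
    rw [LinearMap.comp_apply, hv.scale, map_smul, hv.scale, smul_smul]
    simp)

theorem lin_pivotalIso_hom {V : GVec ω} {a : G} {v : V.carrier} (hv : V.IsHom a v) :
    lin (pivotalIso V).hom v = (evScalar ω a : ℂ) • Module.Dual.eval ℂ V.carrier v := by
  change Module.Dual.eval ℂ V.carrier (V.scale _ v) = _
  rw [hv.scale, map_smul]

theorem lin_pivotalIso_inv {V : GVec ω} {a : G} {v : V.carrier} (hv : V.IsHom a v) :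
    lin (pivotalIso V).inv (Module.Dual.eval ℂ V.carrier v) = ((evScalar ω a)⁻¹ : ℂ) • v := by
  change V.scale _ ((Module.evalEquiv ℂ V.carrier).symm (Module.evalEquiv ℂ V.carrier v)) = _
  rw [LinearEquiv.symm_apply_apply, hv.scale]


theorem tensor_evaluation' {C : Type*} [Category C] [MonoidalCategory C] (X₁ X₂ Y₁ Y₂ : C)
    [ExactPairing X₁ Y₁] [ExactPairing X₂ Y₂] :
    ε_ (X₁ ⊗ X₂) (Y₂ ⊗ Y₁) = (α_ Y₂ Y₁ (X₁ ⊗ X₂)).hom ≫ Y₂ ◁ (α_ Y₁ X₁ X₂).inv ≫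
      Y₂ ◁ (ε_ X₁ Y₁ ▷ X₂) ≫ Y₂ ◁ (λ_ X₂).hom ≫ ε_ X₂ Y₂ := by
  rw [ExactPairing.tensor_evaluation]
  monoidal

theorem lin_tensor_evaluation {V W : GVec ω} {a b c d : G} {v : V.carrier} {w : W.carrier}
    {ψ : Module.Dual ℂ V.carrier} {φ : Module.Dual ℂ W.carrier}
    (hv : V.IsHom a v) (hw : W.IsHom b w) (hψ : V.dualObj.IsHom c ψ) (hφ : W.dualObj.IsHom d φ) :
    lin (ε_ (V ⊗ W) (dual W ⊗ dual V)) ((φ ⊗ₜ[ℂ] ψ) ⊗ₜ[ℂ] (v ⊗ₜ[ℂ] w)) =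
      (tensorScalar ω a b : ℂ) * (ψ v * φ w) := by
  have e1 : lin (α_ (dual W) (dual V) (V ⊗ W)).hom ((φ ⊗ₜ[ℂ] ψ) ⊗ₜ[ℂ] (v ⊗ₜ[ℂ] w)) =
    (ω d c (a * b) : ℂ) • (φ ⊗ₜ[ℂ] (ψ ⊗ₜ[ℂ] (v ⊗ₜ[ℂ] w))) :=
      lin_associator_hom hφ hψ (hv.tmul hw)
  have e2 : lin (dual W ◁ (α_ (dual V) V W).inv) (φ ⊗ₜ[ℂ] (ψ ⊗ₜ[ℂ] (v ⊗ₜ[ℂ] w))) =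
      ((ω c a b)⁻¹ : ℂ) • (φ ⊗ₜ[ℂ] ((ψ ⊗ₜ[ℂ] v) ⊗ₜ[ℂ] w)) := by
    refine (congrArg (fun x => φ ⊗ₜ[ℂ] x) (lin_associator_inv (U := V.dualObj) hψ hv hw)).trans ?_
    exact TensorProduct.tmul_smul _ _ _
  have e3 : lin (dual W ◁ (ε_ V (dual V) ▷ W)) (φ ⊗ₜ[ℂ] ((ψ ⊗ₜ[ℂ] v) ⊗ₜ[ℂ] w)) =
      φ ⊗ₜ[ℂ] (((evScalar ω a : ℂ) * ψ v) ⊗ₜ[ℂ] w) :=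
    congrArg (fun x : ℂ => φ ⊗ₜ[ℂ] (x ⊗ₜ[ℂ] w)) (lin_evaluation ψ hv)
  have e4 : ∀ z : ℂ, lin (dual W ◁ (λ_ W).hom) (φ ⊗ₜ[ℂ] (z ⊗ₜ[ℂ] w)) =
      φ ⊗ₜ[ℂ] ((((ω 1 1 b : ℂ))⁻¹ * z) • w) := fun z =>
    congrArg (fun x => φ ⊗ₜ[ℂ] x) ((lin_leftUnitor_hom z hw).trans (smul_smul _ _ _))
  have e5 : ∀ z : ℂ, lin (ε_ W (dual W)) (φ ⊗ₜ[ℂ] (z • w)) = (evScalar ω b : ℂ) * (z * φ w) :=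
    fun z => by
      rw [lin_evaluation φ (hw.smul z), map_smul]; rfl
  rw [tensor_evaluation']
  simp only [lin_comp_apply]
  rw [e1, map_smul, e2, map_smul, map_smul, map_smul, map_smul]
  erw [e3]
  rw [map_smul, map_smul]
  rw [e4, smul_smul, e5]
  simp only [smul_eq_mul, tensorScalar]
  by_cases h1 : c * a = 1
  · by_cases h2 : d * b = 1
    · obtain rfl : c = a⁻¹ := eq_inv_of_mul_eq_one_left h1
      obtain rfl : d = b⁻¹ := eq_inv_of_mul_eq_one_left h2
      push_cast
      ring_nf
    · rw [dual_apply_eq_zero hφ hw h2]; ring_nf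
  · rw [dual_apply_eq_zero hψ hv h1]; ring_nf

theorem lin_rightDualTensorIso_inv {V W : GVec ω} {a b c d : G} {v : V.carrier} {w : W.carrier}
    {ψ : Module.Dual ℂ V.carrier} {φ : Module.Dual ℂ W.carrier}
    (hv : V.IsHom a v) (hw : W.IsHom b w) (hψ : V.dualObj.IsHom c ψ) (hφ : W.dualObj.IsHom d φ) :
    (evScalar ω (a * b) : ℂ) * (show Module.Dual ℂ (V.carrier ⊗[ℂ] W.carrier) from
      lin (rightDualTensorIso V W).inv (φ ⊗ₜ[ℂ] ψ)) (v ⊗ₜ[ℂ] w) =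
      (tensorScalar ω a b : ℂ) * (ψ v * φ w) := by
  have h := LinearMap.congr_fun (congrArg lin (rightDualTensorIso_inv_eval V W))
    ((φ ⊗ₜ[ℂ] ψ) ⊗ₜ[ℂ] (v ⊗ₜ[ℂ] w))
  rw [lin_tensor_evaluation hv hw hψ hφ] at h
  refine Eq.trans ?_ h
  exact (lin_evaluation (V := V ⊗ W) (lin (rightDualTensorIso V W).inv (φ ⊗ₜ[ℂ] ψ))
    (hv.tmul hw)).symm

/-- The canonical pivotal structure of `C(G, ω)`. -/
def pivotal (ω : ThreeCocycle G) : PivotalStructure (GVec ω) where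
  iso := pivotalIso
  naturality {V W} f := lin_injective (lin_ext fun a v hv => by
    rw [lin_comp_apply, lin_comp_apply, lin_pivotalIso_hom hv, lin_pivotalIso_hom (hv.lin f),
      map_smul, lin_dualMap, lin_dualMap]
    rfl)
  tensor V W := monoidal_of_eval V W _ _ <| lin_injective <|
    TensorProduct.ext <| tensor_ext fun a b v w hv hw =>
      tensor_ext (V := dual W) (W := dual V) fun d c (φ : Module.Dual ℂ W.carrier) (ψ : Module.Dual ℂ V.carrier)
        hφ hψ => by
    change lin ((V ⊗ W) ◁ (rightDualTensorIso V W).inv ≫ (pivotalIso (V ⊗ W)).hom ▷ dual (V ⊗ W) ≫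
        ε_ (dual (V ⊗ W)) (dual (dual (V ⊗ W)))) ((v ⊗ₜ[ℂ] w) ⊗ₜ[ℂ] (φ ⊗ₜ[ℂ] ψ)) =
      lin (((pivotalIso V).hom ⊗ₘ (pivotalIso W).hom) ▷ (dual W ⊗ dual V) ≫
        ε_ (dual W ⊗ dual V) (dual (dual V) ⊗ dual (dual W))) ((v ⊗ₜ[ℂ] w) ⊗ₜ[ℂ] (φ ⊗ₜ[ℂ] ψ))
    have hx := IsHom.lin (rightDualTensorIso V W).inv (hφ.tmul hψ)
    have l1 := lin_evaluation (V := dual (V ⊗ W)) (lin (pivotalIso (V ⊗ W)).hom (v ⊗ₜ[ℂ] w)) hx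
    have l2 : lin (pivotalIso (V ⊗ W)).hom (v ⊗ₜ[ℂ] w) = _ := lin_pivotalIso_hom (hv.tmul hw)
    have l3 := lin_rightDualTensorIso_inv hv hw hψ hφ
    have r1 := lin_tensor_evaluation hφ hψ (isHom_eval hw) (isHom_eval hv)
    have r2 : lin ((pivotalIso V).hom ⊗ₘ (pivotalIso W).hom) (v ⊗ₜ[ℂ] w) =
        ((evScalar ω a : ℂ) * evScalar ω b) •
          (Module.Dual.eval ℂ V.carrier v ⊗ₜ[ℂ] Module.Dual.eval ℂ W.carrier w) := by
      rw [lin_tensorHom_tmul, lin_pivotalIso_hom hv, lin_pivotalIso_hom hw,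
        TensorProduct.tmul_smul, ← TensorProduct.smul_tmul', smul_smul, mul_comm]
    have r3 : lin (((pivotalIso V).hom ⊗ₘ (pivotalIso W).hom) ▷ (dual W ⊗ dual V) ≫
        ε_ (dual W ⊗ dual V) (dual (dual V) ⊗ dual (dual W)))
          ((v ⊗ₜ[ℂ] w) ⊗ₜ[ℂ] (φ ⊗ₜ[ℂ] ψ)) = ((evScalar ω a : ℂ) * evScalar ω b) *
            ((tensorScalar ω d c : ℂ) * (φ w * ψ v)) := by
      rw [lin_comp_apply]
      erw [lin_whiskerRight_tmul]
      rw [r2, ← TensorProduct.smul_tmul', map_smul]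
      erw [r1]
      rfl
    rw [r3]
    refine Eq.trans (b := (evScalar ω (d * c) : ℂ) * ((tensorScalar ω a b : ℂ) * (ψ v * φ w)))
      ?_ ?_
    · rw [← l3]
      refine l1.trans ?_
      exact congrArg (fun x : Module.Dual ℂ (Module.Dual ℂ (V.carrier ⊗[ℂ] W.carrier)) =>
        (evScalar ω (d * c) : ℂ) * x (lin (rightDualTensorIso V W).inv (φ ⊗ₜ[ℂ] ψ))) l2
    · by_cases h1 : c * a = 1
      · by_cases h2 : d * b = 1
        · obtain rfl : c = a⁻¹ := eq_inv_of_mul_eq_one_left h1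
          obtain rfl : d = b⁻¹ := eq_inv_of_mul_eq_one_left h2
          have key := congrArg Units.val (tensorScalar_eq ω a b)
          rw [← mul_inv_rev, evScalar_inv]
          push_cast at key ⊢
          linear_combination (ψ v * φ w) * key
        · rw [dual_apply_eq_zero hφ hw h2]; ring
      · rw [dual_apply_eq_zero hψ hv h1]; ring

end GVec
end

/-!
Let `λ_n(h) = ∏_{i < n} ω(h, hⁱ, h)` (`ThreeCocycle.rotationScalar`). The statement rests on two facts
about these scalars.

In a homogeneous basis `b` of `V`, with `b i` of degree `h_i`, the operator `E_V^{(n)}` permutes the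
monomials of degree `1` in `V^{⊗ n}` cyclically, up to scalars. Only the monomials `b i ⊗ ⋯ ⊗ b i`
are fixed, and the scalar there is `λ_n(h_i)`, the contributions of the unit constraints cancelling
even if `ω` is not normalized. Hence `ν_n(V)` is the sum of `λ_n(h_i)` over those `i` with
`h_iⁿ = 1` (`GVec.indicator_pivotal`), while the pivotal dimension is the number of all `i`
(`GVec.leftDim_pivotal`).

If `hⁿ = 1`, then `λ_n(h)` is multiplicative in `ω` and trivial on coboundaries, so it depends only on
`[ω]` (`ThreeCocycle.rotationScalar_eq_of_cohomologyClass_eq`), and `λ_{nq}(h) = λ_n(h)^q`. For a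
generator `g` of the cyclic group `G` of order `N`, the vanishing of `[ω]` is detected by `λ_N(g)`:
every `N`-th root of unity `ζ` is the value of an explicit cocycle (`ThreeCocycle.ofRoot`), and
`H³(G, ℂˣ)` has exactly `N` elements by the periodic resolution, so each class is represented by one
of these cocycles. Consequently `ord [ω] = ord λ_N(g)`
(`ThreeCocycle.addOrderOf_cohomologyClass`), this order divides `N`, and every divisor of `N` occurs.

With `k = ord [ω]`, for all `h` the scalar `λ_{Nk}(h)` is the value of `λ_N(h)` for the coboundary
`ω^k`, hence `1`, and `ν_{Nk}(V) = dim V` for all `V`. Conversely, for the one-dimensional object in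
degree `g`, `ν_n = 1` forces `n = Nq` with `λ_N(g)^q = 1`, so `Nk` divides `n`.
-/

noncomputable section

set_option linter.unusedSectionVars false

/-! ### Three-cocycles and their classes -/

namespace ThreeCocycle

variable {G : Type} [Group G]

@[ext]
theorem ext {ω ω' : ThreeCocycle G} (h : ∀ a b c, ω a b c = ω' a b c) : ω = ω' := by
  cases ω; cases ω'
  congr
  funext a b c
  exact h a b c

instance : One (ThreeCocycle G) where
  one := ⟨fun _ _ _ => 1, fun _ _ _ _ => by simp⟩

instance : Pow (ThreeCocycle G) ℕ where
  pow ω q := ⟨fun a b c => ω a b c ^ q, fun a b c d => by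
    simp only [← mul_pow, ω.cocycle]⟩

theorem one_apply (a b c : G) : (1 : ThreeCocycle G) a b c = 1 := rfl

theorem pow_apply (ω : ThreeCocycle G) (q : ℕ) (a b c : G) : (ω ^ q) a b c = ω a b c ^ q := rfl

/-- The coboundary of a `2`-cochain. -/
def coboundary (f : G → G → ℂˣ) (a b c : G) : ℂˣ :=
  f b c * (f (a * b) c)⁻¹ * f a (b * c) * (f a b)⁻¹

/-- The element of `Z³(G, ℂˣ)` given by `ω`, in additive notation. -/
def toCocycles (ω : ThreeCocycle G) : groupCohomology.cocycles (units G) 3 :=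
  groupCohomology.cocyclesMk (fun x => Additive.ofMul (ω (x 0) (x 1) (x 2))) ω.d_eq_zero

theorem cohomologyClass_eq (ω : ThreeCocycle G) :
    ω.cohomologyClass = groupCohomology.π (units G) 3 ω.toCocycles := rfl

theorem iCocycles_toCocycles (ω : ThreeCocycle G) :
    groupCohomology.iCocycles (units G) 3 ω.toCocycles =
      fun x => Additive.ofMul (ω (x 0) (x 1) (x 2)) :=
  groupCohomology.iCocycles_mk _ ω.d_eq_zero

theorem iCocycles_injective :
    Function.Injective (groupCohomology.iCocycles (units G) 3) :=
  (ModuleCat.mono_iff_injective _).1 inferInstance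

theorem cohomologyClass_one : (1 : ThreeCocycle G).cohomologyClass = 0 := by
  rw [cohomologyClass_eq, show (1 : ThreeCocycle G).toCocycles = 0 from ?_, map_zero]
  apply iCocycles_injective
  rw [iCocycles_toCocycles, map_zero]
  rfl

theorem cohomologyClass_pow (ω : ThreeCocycle G) (q : ℕ) :
    (ω ^ q).cohomologyClass = q • ω.cohomologyClass := by
  rw [cohomologyClass_eq, cohomologyClass_eq, ← map_nsmul]
  congr 1
  apply iCocycles_injective
  rw [iCocycles_toCocycles, map_nsmul, iCocycles_toCocycles]
  rfl

/-- Equality of classes, spelled out on cochains: `H³` is the cokernel of the map from `2`-cochains to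
`3`-cocycles. -/
theorem exists_eq_mul_coboundary {ω ω' : ThreeCocycle G}
    (h : ω.cohomologyClass = ω'.cohomologyClass) :
    ∃ f : G → G → ℂˣ, ∀ a b c, ω a b c = ω' a b c * coboundary f a b c := by
  rw [cohomologyClass_eq, cohomologyClass_eq, ← sub_eq_zero, ← map_sub] at h
  have hex := CategoryTheory.ShortComplex.exact_of_g_is_cokernel
    (CategoryTheory.ShortComplex.mk _ _
      ((groupCohomology.inhomogeneousCochains (units G)).toCycles_comp_homologyπ 2 3))
    ((groupCohomology.inhomogeneousCochains (units G)).homologyIsCokernel 2 3 (by simp))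
  obtain ⟨y, hy⟩ := (CategoryTheory.ShortComplex.moduleCat_exact_iff _).1 hex _ h
  have hy' : inhomogeneousCochains.d (units G) 2 y =
      groupCohomology.iCocycles (units G) 3 (ω.toCocycles - ω'.toCocycles) := by
    rw [← hy, ← groupCohomology.inhomogeneousCochains.d_def,
      ← (groupCohomology.inhomogeneousCochains (units G)).toCycles_i 2 3]
    rfl
  rw [map_sub, iCocycles_toCocycles, iCocycles_toCocycles] at hy'
  have hy2 : y = fun x : Fin 2 → G => Additive.ofMul (Additive.toMul (y ![x 0, x 1])) := by
    funext x
    exact congrArg y (by funext i; fin_cases i <;> rfl)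
  refine ⟨fun a b => Additive.toMul (y ![a, b]), fun a b c => ?_⟩
  have h3 := congrFun hy' ![a, b, c]
  rw [hy2] at h3
  simp [inhomogeneousCochains.d, Fin.sum_univ_succ, Fin.contractNth] at h3
  have h4 : Additive.ofMul (ω a b c) = Additive.ofMul (ω' a b c) + _ := sub_eq_iff_eq_add'.1 h3.symm
  apply Additive.ofMul.injective
  rw [h4, coboundary]
  simp only [ofMul_mul, ofMul_inv]
  abel

/-! ### The rotation scalar -/

/-- The scalar by which the cyclic rotation of `V^{⊗ n}` acts on `v ⊗ ⋯ ⊗ v` for `v` of degree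
`h` with `h ^ n = 1`. -/
def rotationScalar (ω : ThreeCocycle G) (n : ℕ) (h : G) : ℂˣ :=
  ∏ i ∈ Finset.range n, ω h (h ^ i) h

theorem rotationScalar_one (n : ℕ) (h : G) : rotationScalar 1 n h = 1 := by
  simp [rotationScalar, one_apply]

theorem rotationScalar_pow (ω : ThreeCocycle G) (q n : ℕ) (h : G) :
    rotationScalar (ω ^ q) n h = rotationScalar ω n h ^ q := by
  simp [rotationScalar, pow_apply, Finset.prod_pow]

/-- The factors `ω(h, hⁱ, h)` are periodic in `i` of period `n` if `h ^ n = 1`. -/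
theorem rotationScalar_mul (ω : ThreeCocycle G) {n : ℕ} {h : G} (hn : h ^ n = 1) (q : ℕ) :
    rotationScalar ω (n * q) h = rotationScalar ω n h ^ q := by
  induction q with
  | zero => simp [rotationScalar]
  | succ q ih =>
    rw [Nat.mul_succ, rotationScalar, Finset.prod_range_add, pow_succ, ← ih]
    simp only [pow_add, pow_mul, hn, one_pow, one_mul]
    rfl

/-- The rotation scalar depends only on the class of `ω`, because the product defining it telescopes on
coboundaries. -/
theorem rotationScalar_eq_of_cohomologyClass_eq {ω ω' : ThreeCocycle G}
    (hω : ω.cohomologyClass = ω'.cohomologyClass) {n : ℕ} {h : G} (hn : h ^ n = 1) :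
    rotationScalar ω n h = rotationScalar ω' n h := by
  obtain ⟨f, hf⟩ := exists_eq_mul_coboundary hω
  have key : ∏ i ∈ Finset.range n, coboundary f h (h ^ i) h = 1 := by
    have : ∀ i, coboundary f h (h ^ i) h =
        ((f (h ^ (i + 1)) h)⁻¹ * f h (h ^ (i + 1))) / ((f (h ^ i) h)⁻¹ * f h (h ^ i)) := fun i => by
      rw [coboundary, ← pow_succ', ← pow_succ, div_eq_mul_inv, mul_inv, inv_inv]
      ac_rfl
    simp only [this]
    rw [Finset.prod_range_div (fun i => (f (h ^ i) h)⁻¹ * f h (h ^ i)), hn, pow_zero]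
    exact div_self' _
  simp only [rotationScalar, hf, Finset.prod_mul_distrib, key, mul_one]

end ThreeCocycle
end

noncomputable section

set_option linter.unusedSectionVars false

/-! ### Third cohomology of a finite cyclic group -/

open CategoryTheory

namespace ThreeCocycle

variable {G : Type} [Group G]

section Cyclic

variable [hG : IsCyclic G]

/-- The discrete logarithm to the base `gen`, with values in `{0, …, |G| - 1}`. -/
def dlog (a : G) : ℕ := ((zmodCyclicMulEquiv hG).symm a).toAdd.val

variable (G) in
/-- A generator of the cyclic group `G`. -/
def gen : G := zmodCyclicMulEquiv hG (Multiplicative.ofAdd 1)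

theorem mem_zpowers_gen (a : G) : a ∈ Subgroup.zpowers (gen G) := by
  obtain ⟨x, rfl⟩ := (zmodCyclicMulEquiv hG).surjective a
  obtain ⟨z, hz⟩ := ZMod.intCast_surjective x.toAdd
  refine ⟨z, ?_⟩
  change gen G ^ z = _
  rw [gen, ← map_zpow, ← ofAdd_zsmul]
  congr 1
  rw [zsmul_one, hz]
  rfl

variable [Fintype G]

theorem dlog_mul (a b : G) : dlog (a * b) = (dlog a + dlog b) % Fintype.card G := by
  have : NeZero (Nat.card G) := ⟨Nat.card_pos.ne'⟩
  rw [← Nat.card_eq_fintype_card, dlog, map_mul, toAdd_mul, ZMod.val_add]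
  rfl

theorem dlog_gen_modEq : dlog (gen G) ≡ 1 [MOD Fintype.card G] := by
  rw [dlog, gen, MulEquiv.symm_apply_apply, toAdd_ofAdd, ← Nat.card_eq_fintype_card,
    ← ZMod.natCast_eq_natCast_iff]
  have : NeZero (Nat.card G) := ⟨Nat.card_pos.ne'⟩
  simp

theorem gen_pow_eq_one_iff (n : ℕ) : gen G ^ n = 1 ↔ Fintype.card G ∣ n := by
  rw [← orderOf_dvd_iff_pow_eq_one, orderOf_eq_card_of_forall_mem_zpowers mem_zpowers_gen,
    Nat.card_eq_fintype_card]

/-- The carry in the addition of discrete logarithms: the `2`-cocycle of the extension of `ℤ/N` by `ℤ`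
defined by reduction `ℤ → ℤ/N`. -/
def carry (a b : G) : ℕ := (dlog a + dlog b) / Fintype.card G

theorem dlog_mul_add (a b : G) :
    dlog (a * b) + Fintype.card G * carry a b = dlog a + dlog b := by
  rw [dlog_mul, carry, Nat.mod_add_div]

theorem carry_add_carry (a b c : G) :
    carry b c + carry a (b * c) = carry (a * b) c + carry a b := by
  have h1 := dlog_mul_add b c
  have h2 := dlog_mul_add a (b * c)
  have h3 := dlog_mul_add (a * b) c
  have h4 := dlog_mul_add a b
  rw [← mul_assoc] at h2
  have : Fintype.card G * (carry b c + carry a (b * c)) =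
      Fintype.card G * (carry (a * b) c + carry a b) := by
    rw [mul_add, mul_add]
    omega
  exact Nat.eq_of_mul_eq_mul_left Fintype.card_pos this

/-- The standard `3`-cocycle attached to a root of unity `ζ` with `ζ ^ N = 1`: the cup product of the
character `a ↦ ζ ^ dlog a` with the carry `2`-cocycle. -/
def ofRoot (ζ : rootsOfUnity (Fintype.card G) ℂ) : ThreeCocycle G where
  toFun a b c := (ζ : ℂˣ) ^ (dlog a * carry b c)
  cocycle a b c d := by
    have hζ : (ζ : ℂˣ) ^ Fintype.card G = 1 := ζ.2
    have h : (ζ : ℂˣ) ^ dlog (a * b) = ζ ^ dlog a * ζ ^ dlog b := by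
      rw [← pow_add, ← dlog_mul_add, pow_add, pow_mul, hζ, one_pow, mul_one]
    have h2 := carry_add_carry b c d
    calc (ζ : ℂˣ) ^ (dlog b * carry c d) * ζ ^ (dlog a * carry (b * c) d) *
          ζ ^ (dlog a * carry b c)
        = ζ ^ (dlog b * carry c d) * ζ ^ (dlog a * (carry (b * c) d + carry b c)) := by
          rw [mul_assoc, ← pow_add, ← mul_add]
      _ = (ζ ^ dlog a * ζ ^ dlog b) ^ carry c d * ζ ^ (dlog a * carry b (c * d)) := by
          rw [← h2, ← pow_add _ (dlog a), ← pow_mul, ← pow_add, ← pow_add]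
          congr 1
          ring
      _ = ζ ^ (dlog (a * b) * carry c d) * ζ ^ (dlog a * carry b (c * d)) := by
          rw [← h, ← pow_mul]

theorem ofRoot_apply (ζ : rootsOfUnity (Fintype.card G) ℂ) (a b c : G) :
    ofRoot ζ a b c = (ζ : ℂˣ) ^ (dlog a * carry b c) := rfl

theorem ofRoot_one : ofRoot (1 : rootsOfUnity (Fintype.card G) ℂ) = 1 := by
  ext a b c
  simp [ofRoot_apply, one_apply]

/-- Adding up `N` copies of `dlog gen` returns to `dlog 1`, so the carries account for the whole sum. -/
theorem sum_carry_gen : ∑ i ∈ Finset.range (Fintype.card G), carry (gen G ^ i) (gen G) =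
    dlog (gen G) := by
  have h : ∀ n, dlog (gen G ^ n) + Fintype.card G *
      ∑ i ∈ Finset.range n, carry (gen G ^ i) (gen G) = dlog (gen G ^ 0) + n * dlog (gen G) := by
    intro n
    induction n with
    | zero => simp
    | succ n ih =>
      have := dlog_mul_add (gen G ^ n) (gen G)
      rw [Finset.sum_range_succ, pow_succ, mul_add, Nat.succ_mul]
      omega
  have h1 := h (Fintype.card G)
  rw [(gen_pow_eq_one_iff _).2 dvd_rfl, pow_zero] at h1
  exact Nat.eq_of_mul_eq_mul_left Fintype.card_pos (Nat.add_left_cancel h1)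

theorem rotationScalar_ofRoot (ζ : rootsOfUnity (Fintype.card G) ℂ) :
    rotationScalar (ofRoot ζ) (Fintype.card G) (gen G) = ζ := by
  have hζ : (ζ : ℂˣ) ^ dlog (gen G) = ζ := by
    have := pow_eq_pow_of_modEq (dlog_gen_modEq (G := G))
      (show (ζ : ℂˣ) ^ Fintype.card G = 1 from ζ.2)
    rwa [pow_one] at this
  simp only [rotationScalar, ofRoot_apply, Finset.prod_pow_eq_pow_sum, pow_mul, hζ,
    sum_carry_gen]

theorem ofRoot_class_injective :
    Function.Injective fun ζ : rootsOfUnity (Fintype.card G) ℂ =>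
      (ofRoot (G := G) ζ).cohomologyClass :=
  fun ζ ζ' h => Subtype.ext <| by
    rw [← rotationScalar_ofRoot (G := G) ζ, ← rotationScalar_ofRoot (G := G) ζ']
    exact rotationScalar_eq_of_cohomologyClass_eq h ((gen_pow_eq_one_iff _).2 dvd_rfl)

/-- By the periodic resolution, `H³(G, ℂˣ)` is the kernel of the norm on `ℂˣ`, that is, the group of
`N`-th roots of unity. -/
theorem exists_equiv_rootsOfUnity :
    Nonempty (rootsOfUnity (Fintype.card G) ℂ ≃ groupCohomology (units G) 3) := by
  let : CommGroup G := IsCyclic.commGroup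
  have hodd : Odd 3 := by decide
  let A := units G
  -- For the trivial action the norm is multiplication by `N` and `gen - 1` acts as zero.
  have hnorm : ∀ x : Additive ℂˣ, A.norm.hom.toLinearMap x = Fintype.card G • x := fun x => by
    simp [A, Rep.norm, Representation.norm]
  have hinj : Function.Injective
      (Rep.FiniteCyclicGroup.groupCohomologyπOdd A (gen G) mem_zpowers_gen 3 hodd) := fun x y h => by
    rw [Rep.FiniteCyclicGroup.groupCohomologyπOdd_eq_iff] at h
    obtain ⟨z, hz⟩ := h
    have h0 : (Rep.applyAsHom A (gen G) - 𝟙 A).hom.toLinearMap z = 0 := by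
      simp [A, Rep.sub_hom]
      exact sub_self z
    rw [h0] at hz
    exact Subtype.ext (sub_eq_zero.1 hz.symm)
  have hepi : Epi (Rep.FiniteCyclicGroup.groupCohomologyπOdd A (gen G) mem_zpowers_gen 3 hodd) :=
    epi_comp' (@IsIso.epi_of_iso _ _ _ _ _ (Iso.isIso_inv _)) (epi_comp' inferInstance inferInstance)
  have hsurj : Function.Surjective
      (Rep.FiniteCyclicGroup.groupCohomologyπOdd A (gen G) mem_zpowers_gen 3 hodd) :=
    (ModuleCat.epi_iff_surjective _).1 hepi
  refine ⟨Equiv.trans ?_ (Equiv.ofBijective _ ⟨hinj, hsurj⟩)⟩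
  refine (Additive.ofMul (α := ℂˣ)).subtypeEquiv fun x => ?_
  change x ^ Fintype.card G = 1 ↔ A.norm.hom.toLinearMap (Additive.ofMul x) = 0
  exact Additive.ofMul.injective.eq_iff.symm.trans (Eq.congr_left (hnorm (Additive.ofMul x)).symm)

/-- The `N` classes `[ofRoot ζ]` are distinct, and `H³(G, ℂˣ)` has no more than `N` elements. -/
theorem ofRoot_class_surjective (ω : ThreeCocycle G) :
    ∃ ζ : rootsOfUnity (Fintype.card G) ℂ, ω.cohomologyClass = (ofRoot ζ).cohomologyClass := by
  obtain ⟨e⟩ := exists_equiv_rootsOfUnity (G := G)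
  obtain ⟨ζ, h⟩ := (ofRoot_class_injective (G := G)).surjective_of_finite e ω.cohomologyClass
  exact ⟨ζ, h.symm⟩

/-- The rotation scalar of a generator detects the vanishing of the class. -/
theorem cohomologyClass_eq_zero_iff (ω : ThreeCocycle G) :
    ω.cohomologyClass = 0 ↔ rotationScalar ω (Fintype.card G) (gen G) = 1 := by
  have hN : gen G ^ Fintype.card G = 1 := (gen_pow_eq_one_iff _).2 dvd_rfl
  constructor
  · intro h
    rw [← cohomologyClass_one] at h
    rw [rotationScalar_eq_of_cohomologyClass_eq h hN, rotationScalar_one]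
  · intro h
    obtain ⟨ζ, hζ⟩ := ofRoot_class_surjective ω
    rw [rotationScalar_eq_of_cohomologyClass_eq hζ hN, rotationScalar_ofRoot] at h
    obtain rfl : ζ = 1 := Subtype.ext h
    rw [hζ, ofRoot_one, cohomologyClass_one]

theorem addOrderOf_cohomologyClass (ω : ThreeCocycle G) :
    addOrderOf ω.cohomologyClass = orderOf (rotationScalar ω (Fintype.card G) (gen G)) := by
  refine Nat.dvd_antisymm ?_ ?_
  · rw [addOrderOf_dvd_iff_nsmul_eq_zero, ← cohomologyClass_pow, cohomologyClass_eq_zero_iff,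
      rotationScalar_pow, pow_orderOf_eq_one]
  · rw [orderOf_dvd_iff_pow_eq_one, ← rotationScalar_pow, ← cohomologyClass_eq_zero_iff,
      cohomologyClass_pow, addOrderOf_nsmul_eq_zero]

theorem addOrderOf_cohomologyClass_dvd (ω : ThreeCocycle G) :
    addOrderOf ω.cohomologyClass ∣ Fintype.card G := by
  obtain ⟨ζ, hζ⟩ := ofRoot_class_surjective ω
  rw [hζ, addOrderOf_cohomologyClass, rotationScalar_ofRoot, orderOf_dvd_iff_pow_eq_one]
  exact ζ.2

theorem exists_addOrderOf_eq {n : ℕ} (hn : n ∣ Fintype.card G) :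
    ∃ ω : ThreeCocycle G, addOrderOf ω.cohomologyClass = n := by
  have hn0 : n ≠ 0 := fun h => Fintype.card_ne_zero (α := G) (Nat.eq_zero_of_zero_dvd (h ▸ hn))
  have hζ := Complex.isPrimitiveRoot_exp n hn0
  obtain ⟨ζ, hζ'⟩ := hζ.isUnit hn0
  rw [← hζ'] at hζ
  have hp : IsPrimitiveRoot ζ n := IsPrimitiveRoot.coe_units_iff.1 hζ
  refine ⟨ofRoot ⟨ζ, ?_⟩, ?_⟩
  · exact (hp.pow_eq_one_iff_dvd _).2 hn
  · rw [addOrderOf_cohomologyClass, rotationScalar_ofRoot]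
    exact hp.eq_orderOf.symm

end Cyclic

end ThreeCocycle
end

noncomputable section

set_option linter.unusedSectionVars false

/-! ### Homogeneous bases and dimensions -/

open CategoryTheory MonoidalCategory TensorProduct FrobeniusSchur ThreeCocycle

namespace GVec

variable {G : Type} [Group G] [Fintype G] [DecidableEq G] {ω : ThreeCocycle G}

/-- The homogeneous vectors span `V`, so they contain a basis. -/
theorem exists_isHom_basis (V : GVec ω) : ∃ (ι : Type) (_ : Fintype ι)
    (b : Module.Basis ι ℂ V.carrier) (deg : ι → G), ∀ i, V.IsHom (deg i) (b i) := by
  have hs : ⊤ ≤ Submodule.span ℂ {v : V.carrier | ∃ g, V.IsHom g v} := fun v _ => by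
    rw [← V.sum_proj v]
    exact Submodule.sum_mem _ fun g _ => Submodule.subset_span ⟨g, V.isHom_proj g v⟩
  let b := Module.Basis.ofSpan hs
  have hb : ∀ i, ∃ g, V.IsHom g (b i) := fun i => Module.Basis.ofSpan_subset hs ⟨i, rfl⟩
  choose deg hdeg using hb
  exact ⟨_, FiniteDimensional.fintypeBasisIndex b, b, deg, hdeg⟩

theorem coevaluation_eq_sum {V : GVec ω} {ι : Type} [Fintype ι] (b : Module.Basis ι ℂ V.carrier) :
    coevaluation ℂ (Module.Dual ℂ V.carrier) 1 =
      ∑ i, b.coord i ⊗ₜ[ℂ] Module.Dual.eval ℂ V.carrier (b i) := by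
  refine contractVec_injective (V := V.dualObj) fun φ => ?_
  rw [contractVec_coevaluation, one_smul, map_sum]
  have h : ∀ i, contractVec V.dualObj φ (b.coord i ⊗ₜ[ℂ] Module.Dual.eval ℂ V.carrier (b i)) =
      (show Module.Dual ℂ V.carrier from φ) (b i) • b.coord i := fun i => rfl
  exact (b.sum_dual_apply_smul_coord φ).symm.trans (Finset.sum_congr rfl fun i _ => (h i).symm)

theorem isHom_coord {V : GVec ω} {ι : Type} {b : Module.Basis ι ℂ V.carrier} {deg : ι → G}
    (hb : ∀ i, V.IsHom (deg i) (b i)) (i : ι) : V.dualObj.IsHom (deg i)⁻¹ (b.coord i) := by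
  change (V.proj (deg i)⁻¹⁻¹).dualMap (b.coord i) = b.coord i
  refine b.ext fun j => ?_
  rw [LinearMap.dualMap_apply, inv_inv, (hb j).proj_eq]
  split_ifs with h
  · rfl
  · have : j ≠ i := fun e => h (by rw [e])
    simp [this]

/-- The scalars of the evaluation and of the inverse pivotal isomorphism cancel, so the pivotal
dimension is the dimension of the underlying vector space. -/
theorem leftDim_pivotal (V : GVec ω) :
    leftDim (pivotal ω) V = (Module.finrank ℂ V.carrier : ℂ) • 𝟙 (𝟙_ (GVec ω)) := by
  obtain ⟨ι, _, b, deg, hb⟩ := exists_isHom_basis V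
  refine lin_injective (LinearMap.ext_ring ?_)
  change lin (ε_ V (dual V)) (lin (dual V ◁ (pivotalIso V).inv)
    (coevaluation ℂ (Module.Dual ℂ V.carrier) 1)) = (Module.finrank ℂ V.carrier : ℂ) • (1 : ℂ)
  rw [coevaluation_eq_sum b, map_sum, map_sum]
  have h : ∀ i, lin (ε_ V (dual V)) (lin (dual V ◁ (pivotalIso V).inv)
      (b.coord i ⊗ₜ[ℂ] Module.Dual.eval ℂ V.carrier (b i))) = (1 : ℂ) := fun i => by
    erw [lin_whiskerLeft_tmul, lin_pivotalIso_inv (hb i)]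
    rw [lin_evaluation _ ((hb i).smul _)]
    simp
  refine (Finset.sum_congr rfl fun i _ => h i).trans ?_
  rw [Module.finrank_eq_card_basis b]
  rw [Finset.sum_const, smul_eq_mul, mul_one]
  exact nsmul_one (A := ℂ) (Fintype.card ι)

/-! ### The map `E` on basis vectors -/

/-- A morphism `K` out of `V^∨` that is the contraction of `b k ⊗ w` with a functional turns the
coevaluation of `V^∨` into `w ⊗ b k`, up to the scalar of the pivotal isomorphism. -/
theorem lin_coevaluation_comp {V W : GVec ω} {ι : Type} [Fintype ι]
    {b : Module.Basis ι ℂ V.carrier} {deg : ι → G} (hb : ∀ i, V.IsHom (deg i) (b i))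
    {k : ι} {w : W.carrier} {K : dual V ⟶ W}
    (hK : ∀ i, lin K (b.coord i) = (b.coord i) (b k) • w) :
    lin (η_ (dual V) (dual (dual V)) ≫ K ▷ dual (dual V) ≫ W ◁ (pivotalIso V).inv) (1 : ℂ) =
      ((evScalar ω (deg k))⁻¹ : ℂ) • (w ⊗ₜ[ℂ] b k) := by
  have h : ∀ i, lin (K ▷ dual (dual V) ≫ W ◁ (pivotalIso V).inv)
      (b.coord i ⊗ₜ[ℂ] Module.Dual.eval ℂ V.carrier (b i)) =
        (b.coord i (b k) * ((evScalar ω (deg i) : ℂ))⁻¹) • (w ⊗ₜ[ℂ] b i) := fun i => by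
    refine (congrArg₂ (fun (x : W.carrier) (y : V.carrier) => x ⊗ₜ[ℂ] y) (hK i)
      (lin_pivotalIso_inv (hb i))).trans ?_
    exact TensorProduct.smul_tmul_smul (R := ℂ) _ _ w (b i)
  change lin (K ▷ dual (dual V) ≫ W ◁ (pivotalIso V).inv)
    (coevaluation ℂ (Module.Dual ℂ V.carrier) 1) = _
  rw [coevaluation_eq_sum b, map_sum]
  refine (Finset.sum_congr rfl fun i _ => h i).trans ?_
  rw [Finset.sum_eq_single k]
  · simp
  · intro i _ hi
    simp [hi.symm]
  · simp

/-- `E` interchanges the factors of `b k ⊗ w` up to a scalar. The scalars of the unit, associativity and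
evaluation morphisms cancel by `evScalar_eq`; that of the pivotal isomorphism remains. -/
theorem lin_mapE {V W : GVec ω} {ι : Type} [Fintype ι] {b : Module.Basis ι ℂ V.carrier}
    {deg : ι → G} (hb : ∀ i, V.IsHom (deg i) (b i)) (k : ι) {w : W.carrier}
    (hw : W.IsHom (deg k)⁻¹ w) {f : 𝟙_ (GVec ω) ⟶ V ⊗ W} (hf : lin f (1 : ℂ) = b k ⊗ₜ[ℂ] w) :
    lin (mapE ℂ (pivotal ω) V W f) (1 : ℂ) =
      ((evScalar ω (deg k))⁻¹ : ℂ) • (w ⊗ₜ[ℂ] b k) := by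
  refine lin_coevaluation_comp hb (K := _) fun i => ?_
  change lin ((ρ_ (dual V)).inv ≫ dual V ◁ f ≫ (α_ (dual V) V W).inv ≫
    ε_ V (dual V) ▷ W ≫ (λ_ W).hom) (b.coord i) = b.coord i (b k) • w 

  have hi := isHom_coord hb i
  have e1 : lin (ρ_ (dual V)).inv (b.coord i) = _ := lin_rightUnitor_inv (V := V.dualObj) hi
  have e2 : lin (dual V ◁ f) (b.coord i ⊗ₜ[ℂ] (1 : ℂ)) = b.coord i ⊗ₜ[ℂ] (b k ⊗ₜ[ℂ] w) :=
    congrArg (fun x => b.coord i ⊗ₜ[ℂ] x) hf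
  have e3 : lin (α_ (dual V) V W).inv (b.coord i ⊗ₜ[ℂ] (b k ⊗ₜ[ℂ] w)) = _ :=
    lin_associator_inv (U := V.dualObj) hi (hb k) hw
  have e4 : lin (ε_ V (dual V) ▷ W) ((b.coord i ⊗ₜ[ℂ] b k) ⊗ₜ[ℂ] w) =
      ((evScalar ω (deg k) : ℂ) * b.coord i (b k)) ⊗ₜ[ℂ] w :=
    congrArg (fun x : ℂ => x ⊗ₜ[ℂ] w) (lin_evaluation (b.coord i) (hb k))
  have e5 := fun z : ℂ => lin_leftUnitor_hom z hw
  rw [lin_comp_apply, e1, map_smul, lin_comp_apply]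
  erw [e2]
  rw [lin_comp_apply, e3, map_smul, lin_comp_apply]
  erw [e4, e5]
  by_cases h : i = k
  · subst h
    rw [smul_smul, smul_smul, smul_smul]
    congr 1
    rw [evScalar_eq]
    push_cast
    field_simp
  · have : b.coord i (b k) = 0 := by simp [Ne.symm h]
    rw [this]
    simp
/-! ### Monomials in tensor powers -/

/-- Index set of the monomial basis of `V^{⊗ n}`: words of length `n`, right-nested like `tpow`. -/
def Word (ι : Type) : ℕ → Type
  | 0 => Unit
  | n + 1 => ι × Word ι n

namespace Word

variable {ι : Type}

instance [Fintype ι] : ∀ n, Fintype (Word ι n)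
  | 0 => inferInstanceAs (Fintype Unit)
  | n + 1 =>
    have := instFintype n
    inferInstanceAs (Fintype (ι × Word ι n))

/-- Put a letter in front of a word. -/
def cons {n : ℕ} (i : ι) (J : Word ι n) : Word ι (n + 1) := (i, J)

theorem sum_succ [Fintype ι] {n : ℕ} (f : Word ι (n + 1) → ℂ) :
    ∑ J, f J = ∑ i, ∑ J : Word ι n, f (cons i J) := Fintype.sum_prod_type f

/-- Append a letter at the end of a word. -/
def snoc : ∀ {n}, Word ι n → ι → Word ι (n + 1)
  | 0, _, i => (i, ())
  | _ + 1, (j, J), i => (j, snoc J i)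

/-- The constant word. -/
def const (i : ι) : ∀ n, Word ι n
  | 0 => ()
  | n + 1 => (i, const i n)

theorem snoc_const (i : ι) : ∀ n, snoc (const i n) i = cons i (const i n)
  | 0 => rfl
  | n + 1 => congrArg (Prod.mk i) (snoc_const i n)

/-- A word fixed by cyclic rotation by one place is constant. -/
theorem eq_const_of_snoc_eq {i : ι} : ∀ {n} {J : Word ι n}, snoc J i = cons i J → J = const i n
  | 0, _, _ => rfl
  | n + 1, (j, J), h => by
    obtain ⟨rfl, h2⟩ := Prod.mk.inj h
    exact congrArg (Prod.mk j) (eq_const_of_snoc_eq h2)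

/-- The degree of a monomial. -/
def degree (deg : ι → G) : ∀ {n}, Word ι n → G
  | 0, _ => 1
  | _ + 1, (j, J) => deg j * degree deg J

theorem degree_const (deg : ι → G) (i : ι) : ∀ n, degree deg (const i n) = deg i ^ n
  | 0 => (pow_zero _).symm
  | n + 1 => by rw [const, degree, degree_const deg i n, pow_succ']

/-- The scalar by which rebracketing acts on a monomial of `V^{⊗ n} ⊗ V`. -/
def rebracketScalar (ω : ThreeCocycle G) (deg : ι → G) : ∀ {n}, Word ι n → ι → ℂˣ
  | 0, _, i => (ω (deg i) 1 1)⁻¹ * (ω 1 1 (deg i))⁻¹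
  | _ + 1, (j, J), i => ω (deg j) (degree deg J) (deg i) * rebracketScalar ω deg J i

theorem rebracketScalar_const (deg : ι → G) (i : ι) : ∀ n,
    rebracketScalar ω deg (const i n) i =
      (ω (deg i) 1 1)⁻¹ * (ω 1 1 (deg i))⁻¹ * rotationScalar ω n (deg i)
  | 0 => by simp [rebracketScalar, rotationScalar]
  | n + 1 => by
    rw [const, rebracketScalar, rebracketScalar_const deg i n, degree_const, rotationScalar,
      rotationScalar, Finset.prod_range_succ]
    ac_rfl

end Word

/-- The basis of monomials of `V^{⊗ n}`. -/
def tpowBasis {V : GVec ω} {ι : Type} (b : Module.Basis ι ℂ V.carrier) :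
    ∀ n, Module.Basis (Word ι n) ℂ (tpow V n).carrier
  | 0 => Module.Basis.singleton Unit ℂ
  | n + 1 => b.tensorProduct (tpowBasis b n)

theorem tpowBasis_succ {V : GVec ω} {ι : Type} (b : Module.Basis ι ℂ V.carrier) {n : ℕ} (i : ι)
    (J : Word ι n) : tpowBasis b (n + 1) (Word.cons i J) = b i ⊗ₜ[ℂ] tpowBasis b n J :=
  Module.Basis.tensorProduct_apply _ _ _ _

section

variable {V : GVec ω} {ι : Type} {b : Module.Basis ι ℂ V.carrier} {deg : ι → G}

theorem isHom_tpowBasis (hb : ∀ i, V.IsHom (deg i) (b i)) :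
    ∀ {n} (J : Word ι n), (tpow V n).IsHom (J.degree deg) (tpowBasis b n J)
  | 0, _ => isHom_unit (ω := ω) _
  | n + 1, (i, J) => by
    change (tpow V (n + 1)).IsHom _ (tpowBasis b (n + 1) (Word.cons i J))
    rw [tpowBasis_succ]
    exact (hb i).tmul (isHom_tpowBasis hb J)

theorem lin_rebracket (hb : ∀ i, V.IsHom (deg i) (b i)) : ∀ {n} (J : Word ι n) (i : ι),
    lin (W := tpow V (n + 1)) (rebracket V n).hom (tpowBasis b n J ⊗ₜ[ℂ] b i) =
      (J.rebracketScalar ω deg i : ℂ) • tpowBasis b (n + 1) (J.snoc i)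
  | 0, J, i => by
    have h0 : tpowBasis b 0 J = (1 : ℂ) := Module.Basis.singleton_apply Unit ℂ ()
    have h1 : lin (λ_ V).hom ((1 : ℂ) ⊗ₜ[ℂ] b i) = _ := lin_leftUnitor_hom 1 (hb i)
    have h2 : tpowBasis b 1 (J.snoc i) = b i ⊗ₜ[ℂ] (1 : ℂ) :=
      (tpowBasis_succ b i J).trans (congrArg (fun z : ℂ => b i ⊗ₜ[ℂ] z) h0)
    rw [h0, h2]
    refine (congrArg (lin (ρ_ V).inv) h1).trans ?_
    rw [one_smul, map_smul, lin_rightUnitor_inv (hb i), smul_smul, Word.rebracketScalar, mul_comm]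
    push_cast
    rfl
  | n + 1, (j, J), i => by
    have h1 : lin (α_ V (tpow V n) V).hom (tpowBasis b (n + 1) (Word.cons j J) ⊗ₜ[ℂ] b i) =
        (ω (deg j) (J.degree deg) (deg i) : ℂ) • (b j ⊗ₜ[ℂ] (tpowBasis b n J ⊗ₜ[ℂ] b i)) := by
      rw [tpowBasis_succ]
      exact lin_associator_hom (hb j) (isHom_tpowBasis hb J) (hb i)
    have h2 : lin (V ◁ (rebracket V n).hom) (b j ⊗ₜ[ℂ] (tpowBasis b n J ⊗ₜ[ℂ] b i)) =
        (J.rebracketScalar ω deg i : ℂ) • tpowBasis b (n + 2) (Word.cons j (J.snoc i)) := by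
      rw [tpowBasis_succ]
      exact (congrArg (fun x : (tpow V (n + 1)).carrier => b j ⊗ₜ[ℂ] x) (lin_rebracket hb J i)).trans
        (TensorProduct.tmul_smul _ _ _)
    refine (congrArg (lin (V ◁ (rebracket V n).hom)) h1).trans ?_
    rw [map_smul, h2, Word.rebracketScalar, Units.val_mul]
    exact smul_smul _ _ _

end

/-! ### The trace -/

/-- Evaluation of a morphism out of the unit object at `1`. -/
def evalOne (X : GVec ω) : (𝟙_ (GVec ω) ⟶ X) →ₗ[ℂ] X.carrier where
  toFun f := lin f (1 : ℂ)
  map_add' _ _ := rfl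
  map_smul' _ _ := rfl

/-- The morphism out of the unit object with value at `1` the component of degree `1` of a
vector. -/
def ofVec (X : GVec ω) : X.carrier →ₗ[ℂ] (𝟙_ (GVec ω) ⟶ X) where
  toFun x := ⟨LinearMap.toSpanSingleton ℂ X.carrier (X.proj 1 x),
    comm_single (V := unitObj ω) fun a (z : ℂ) hz => by
      by_cases h : a = 1
      · subst h
        exact (X.isHom_proj 1 x).smul z
      · have h0 : z = 0 := by
          rw [← hz]
          change (if a = 1 then LinearMap.id else (0 : ℂ →ₗ[ℂ] ℂ)) z = 0
          rw [if_neg h, LinearMap.zero_apply]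
        rw [h0, map_zero]
        exact map_zero _⟩
  map_add' x y := lin_injective (LinearMap.ext fun (z : ℂ) => by
    change z • X.proj 1 (x + y) = z • X.proj 1 x + z • X.proj 1 y
    rw [map_add, smul_add])
  map_smul' c x := lin_injective (LinearMap.ext fun (z : ℂ) => by
    change z • X.proj 1 (c • x) = c • z • X.proj 1 x
    rw [map_smul, smul_comm])

theorem lin_ofVec_one {X : GVec ω} (x : X.carrier) : lin (ofVec X x) (1 : ℂ) = X.proj 1 x :=
  one_smul ℂ _

theorem ofVec_comp_evalOne (X : GVec ω) : ofVec X ∘ₗ evalOne X = LinearMap.id :=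
  LinearMap.ext fun f => lin_injective <| LinearMap.ext_ring <| by
    refine (lin_ofVec_one (lin f (1 : ℂ))).trans ?_
    rw [lin_comm]
    exact congrArg (lin f) (isHom_unit (ω := ω) 1)

/-- `Hom(𝟙, X)` is a retract of the vector space `X`, so the trace of an endomorphism can be computed
on `X`, where a basis of monomials is available. -/
theorem trace_eq_trace_carrier {X : GVec ω} (E : (𝟙_ (GVec ω) ⟶ X) →ₗ[ℂ] (𝟙_ (GVec ω) ⟶ X)) :
    LinearMap.trace ℂ _ E = LinearMap.trace ℂ X.carrier (evalOne X ∘ₗ E ∘ₗ ofVec X) := by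
  rw [LinearMap.trace_comp_comm', LinearMap.comp_assoc, ofVec_comp_evalOne, LinearMap.comp_id]

/-- The matrix of `E_V^{(n)}` in the monomial basis is a monomial matrix for the cyclic rotation of words,
so only the constant words of degree `1` contribute to the trace. -/
theorem indicator_pivotal {V : GVec ω} {ι : Type} [Fintype ι] {b : Module.Basis ι ℂ V.carrier}
    {deg : ι → G} (hb : ∀ i, V.IsHom (deg i) (b i)) {n : ℕ} (hn : 0 < n) :
    indicator ℂ (pivotal ω) V n =
      ∑ i, if deg i ^ n = 1 then (rotationScalar ω n (deg i) : ℂ) else 0 := by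
  classical
  obtain ⟨n, rfl⟩ := Nat.exists_eq_succ_of_ne_zero hn.ne'
  -- `T` is `E_V^{(n + 1)}` carried over to the vector space, and zero in degrees other than `1`.
  let X := tpow V (n + 1)
  let E : (𝟙_ (GVec ω) ⟶ X) →ₗ[ℂ] (𝟙_ (GVec ω) ⟶ X) := powE ℂ (pivotal ω) V n
  let T : X.carrier →ₗ[ℂ] X.carrier := evalOne X ∘ₗ E ∘ₗ ofVec X
  let B : Module.Basis (Word ι (n + 1)) ℂ X.carrier := tpowBasis b (n + 1)
  have hproj : ∀ i J, X.proj 1 (B (Word.cons i J)) =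
      if deg i * J.degree deg = 1 then B (Word.cons i J) else 0 :=
    fun i J => (isHom_tpowBasis hb (Word.cons i J)).proj_eq 1
  have hT : ∀ i J, deg i * J.degree deg = 1 → T (B (Word.cons i J)) =
      (((evScalar ω (deg i))⁻¹ * J.rebracketScalar ω deg i : ℂˣ) : ℂ) • B (J.snoc i) := by
    intro i J h
    have hJ : J.degree deg = (deg i)⁻¹ := eq_inv_of_mul_eq_one_right h
    have hf : lin (ofVec X (B (Word.cons i J))) (1 : ℂ) = b i ⊗ₜ[ℂ] tpowBasis b n J := by
      rw [lin_ofVec_one, hproj, if_pos h]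
      exact tpowBasis_succ b i J
    have h1 := lin_mapE hb i (hJ ▸ isHom_tpowBasis hb J) hf
    refine (congrArg (lin (W := X) (rebracket V n).hom) h1).trans ?_
    rw [map_smul, lin_rebracket hb J i, smul_smul]
    push_cast
    rfl
  have hT0 : ∀ i J, deg i * J.degree deg ≠ 1 → T (B (Word.cons i J)) = 0 := by
    intro i J h
    have : ofVec X (B (Word.cons i J)) = 0 := lin_injective <| LinearMap.ext_ring <| by
      refine (lin_ofVec_one (B (Word.cons i J))).trans ?_
      rw [hproj, if_neg h]
      rfl
    simp only [T, LinearMap.comp_apply, this, map_zero]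
  change LinearMap.trace ℂ (𝟙_ (GVec ω) ⟶ X) E = _
  rw [trace_eq_trace_carrier, LinearMap.trace_eq_matrix_trace ℂ B, Matrix.trace, Word.sum_succ]
  refine Finset.sum_congr rfl fun i _ => ?_
  have hdiag : ∀ J : Word ι n, (LinearMap.toMatrix B B T).diag (Word.cons i J) =
      B.repr (T (B (Word.cons i J))) (Word.cons i J) :=
    fun J => LinearMap.toMatrix_apply _ _ _ _ _
  refine (Finset.sum_congr rfl fun J _ => hdiag J).trans ?_
  rw [Finset.sum_eq_single (Word.const i n)]
  · by_cases h : deg i ^ (n + 1) = 1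
    · have h' : deg i * (Word.const i n).degree deg = 1 := by
        rw [Word.degree_const, ← pow_succ', h]
      rw [if_pos h, hT i _ h', Word.snoc_const, map_smul, B.repr_self, Finsupp.smul_single,
        Finsupp.single_eq_same, smul_eq_mul, mul_one, Word.rebracketScalar_const]
      congr 1
      -- The factor `ω(g, g⁻¹, g)` of `evScalar⁻¹` is the last one of the product, as `gⁿ = g⁻¹`.
      rw [evScalar, inv_inv, rotationScalar, rotationScalar, Finset.prod_range_succ,
        eq_inv_of_mul_eq_one_right ((pow_succ' (deg i) n).symm.trans h)]
      rw [← mul_assoc, mul_comm, ← mul_inv_cancel_right (ω (deg i) (deg i)⁻¹ (deg i))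
        (ω 1 1 (deg i) * ω (deg i) 1 1)]
      group
    · have h' : deg i * (Word.const i n).degree deg ≠ 1 := by
        rwa [Word.degree_const, ← pow_succ']
      rw [if_neg h, hT0 i _ h', map_zero, Finsupp.zero_apply]
  · intro J _ hJ
    by_cases h : deg i * J.degree deg = 1
    · rw [hT i J h, map_smul, B.repr_self, Finsupp.smul_single, Finsupp.single_apply,
        if_neg fun e => hJ (Word.eq_const_of_snoc_eq e)]
    · rw [hT0 i J h, map_zero, Finsupp.zero_apply]
  · simp

end GVec
end

noncomputable section

set_option linter.unusedSectionVars false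

/-! ### The exponent -/

open CategoryTheory MonoidalCategory TensorProduct FrobeniusSchur ThreeCocycle

namespace GVec

variable {G : Type} [Group G] [Fintype G] [DecidableEq G] {ω : ThreeCocycle G}

/-- The simple object of degree `g`: the line `ℂ` in degree `g`. -/
def simpleObj (ω : ThreeCocycle G) (g : G) : GVec ω where
  carrier := ℂ
  proj h := if h = g then LinearMap.id else 0
  proj_proj h v := by split_ifs <;> simp
  proj_proj_of_ne h k v hhk := by
    split_ifs with h1 h2
    · exact absurd (h1.trans h2.symm) hhk
    all_goals simp
  sum_proj v := by simp [apply_ite (fun f : ℂ →ₗ[ℂ] ℂ => f v)]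

theorem isHom_simpleObj (ω : ThreeCocycle G) (g : G) (z : ℂ) : (simpleObj ω g).IsHom g z := by
  change (if g = g then LinearMap.id else (0 : ℂ →ₗ[ℂ] ℂ)) z = z
  rw [if_pos rfl, LinearMap.id_apply]

theorem indicator_smul_eq_leftDim_iff (V : GVec ω) (n : ℕ) :
    indicator ℂ (pivotal ω) V n • 𝟙 (𝟙_ (GVec ω)) = leftDim (pivotal ω) V ↔
      indicator ℂ (pivotal ω) V n = Module.finrank ℂ V.carrier := by
  rw [leftDim_pivotal]
  refine ⟨fun h => ?_, fun h => by rw [h]⟩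
  have h1 : indicator ℂ (pivotal ω) V n • (1 : ℂ) = (Module.finrank ℂ V.carrier : ℂ) • (1 : ℂ) :=
    LinearMap.congr_fun (congrArg lin h) (1 : ℂ)
  simpa using h1

theorem indicator_simpleObj (g : G) {n : ℕ} (hn : 0 < n) :
    indicator ℂ (pivotal ω) (simpleObj ω g) n =
      if g ^ n = 1 then (rotationScalar ω n g : ℂ) else 0 := by
  rw [indicator_pivotal (V := simpleObj ω g) (b := Module.Basis.singleton Unit ℂ)
    (deg := fun _ => g) (fun _ => isHom_simpleObj ω g _) hn]
  simp

/-- The bound `≤` holds for every object because `ω ^ ord [ω]` is a coboundary; the simple object in the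
degree of a generator attains it. -/
theorem fsExp_pivotal [IsCyclic G] (ω : ThreeCocycle G) :
    fsExp ℂ (pivotal ω) = ((Fintype.card G * addOrderOf ω.cohomologyClass : ℕ) : ℕ∞) := by
  have hpos : 0 < Fintype.card G * addOrderOf ω.cohomologyClass := Nat.mul_pos Fintype.card_pos
    (Nat.pos_of_dvd_of_pos ω.addOrderOf_cohomologyClass_dvd Fintype.card_pos)
  refine le_antisymm (iSup_le fun V => ?_) ?_
  · refine iInf₂_le _ ⟨hpos, ?_⟩
    rw [indicator_smul_eq_leftDim_iff]
    obtain ⟨ι, _, b, deg, hb⟩ := exists_isHom_basis V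
    have hclass : (ω ^ addOrderOf ω.cohomologyClass).cohomologyClass =
        (1 : ThreeCocycle G).cohomologyClass := by
      rw [cohomologyClass_pow, addOrderOf_nsmul_eq_zero, cohomologyClass_one]
    rw [indicator_pivotal hb hpos, Module.finrank_eq_card_basis b]
    have h : ∀ i, (if deg i ^ (Fintype.card G * addOrderOf ω.cohomologyClass) = 1 then
        (rotationScalar ω (Fintype.card G * addOrderOf ω.cohomologyClass) (deg i) : ℂ) else 0) =
          1 := fun i => by
      rw [if_pos (by rw [pow_mul, pow_card_eq_one, one_pow]),
        rotationScalar_mul ω pow_card_eq_one, ← rotationScalar_pow,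
        rotationScalar_eq_of_cohomologyClass_eq hclass pow_card_eq_one, rotationScalar_one,
        Units.val_one]
    simp [h]
  · refine le_trans ?_ (le_iSup (fun V : GVec ω => fsExpObj ℂ (pivotal ω) V) (simpleObj ω (gen G)))
    refine le_iInf₂ fun n ⟨hn, h⟩ => ?_
    refine Nat.cast_le.2 (Nat.le_of_dvd hn ?_)
    rw [indicator_smul_eq_leftDim_iff, indicator_simpleObj _ hn] at h
    have hdim : Module.finrank ℂ (simpleObj ω (gen G)).carrier = 1 := Module.finrank_self ℂ
    rw [hdim, Nat.cast_one] at h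
    split_ifs at h with hg
    · obtain ⟨q, rfl⟩ := (gen_pow_eq_one_iff n).1 hg
      rw [Units.val_eq_one, rotationScalar_mul ω pow_card_eq_one] at h
      rw [addOrderOf_cohomologyClass]
      exact mul_dvd_mul_left _ (orderOf_dvd_of_pow_eq_one h)
    · exact absurd h zero_ne_one

end GVec
end

theorem mainTheorem10 (G : Type) [Group G] [Fintype G] [DecidableEq G] [IsCyclic G] :
    (∀ ω : ThreeCocycle G,
      FrobeniusSchur.fsExp ℂ (GVec.pivotal ω) =
        ((Fintype.card G * addOrderOf ω.cohomologyClass : ℕ) : ℕ∞)) ∧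
    (∀ ω : ThreeCocycle G, ∃ m : ℕ, FrobeniusSchur.fsExp ℂ (GVec.pivotal ω) = (m : ℕ∞) ∧
      Fintype.card G ∣ m ∧ m ∣ Fintype.card G ^ 2) ∧
    (∀ n : ℕ, n ∣ Fintype.card G → ∃ ω : ThreeCocycle G,
      FrobeniusSchur.fsExp ℂ (GVec.pivotal ω) = ((Fintype.card G * n : ℕ) : ℕ∞)) ∧
    (∃ ω : ThreeCocycle G,
      FrobeniusSchur.fsExp ℂ (GVec.pivotal ω) = ((Fintype.card G ^ 2 : ℕ) : ℕ∞)) := by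
  have hattain : ∀ n : ℕ, n ∣ Fintype.card G → ∃ ω : ThreeCocycle G,
      FrobeniusSchur.fsExp ℂ (GVec.pivotal ω) = ((Fintype.card G * n : ℕ) : ℕ∞) := fun n hn => by
    obtain ⟨ω, hω⟩ := ThreeCocycle.exists_addOrderOf_eq hn
    exact ⟨ω, by rw [GVec.fsExp_pivotal, hω]⟩
  refine ⟨GVec.fsExp_pivotal, fun ω => ⟨_, GVec.fsExp_pivotal ω, dvd_mul_right _ _, ?_⟩,
    hattain, ?_⟩
  · rw [sq]
    exact mul_dvd_mul_left _ ω.addOrderOf_cohomologyClass_dvd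
  · rw [sq]
    exact hattain _ dvd_rfl
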